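/- Conventions. A quiver $Q$ consists of finite sets $V(Q)$ (vertices) and $E(Q)$ (edges) with maps $s,t\colon E(Q)\to V(Q)$; its geometric realization is the 1-dimensional CW complex with the vertices as 0-cells and the edges as 1-cells. The genus of $Q$ is the first Betti number of its realization, and a directed tree is a (non-empty) connected quiver of genus $0$. A digraph is a quiver in which each edge $e$ is determined by the ordered pair $(s(e),t(e))$. A minor morphism $\phi\colon Q'\to Q$ is a map of sets $V(Q')\sqcup E(Q')\sqcup\{\star\}\to V(Q)\sqcup E(Q)\sqcup\{\star\}$ such that (i) $\phi(V(Q'))=V(Q)$ and $\phi(\star)=\star$; (ii) if $e\in E(Q')$ and $\phi(e)\neq\star$, then either $\phi(e)=\phi(s(e))=\phi(t(e))$ is a vertex of $Q$, or $\phi(e)$ is an edge of $Q$ with source $\phi(s(e))$ and target $\phi(t(e))$; (iii) $\phi$ restricts to a bijection $\phi^{-1}(E(Q))\to E(Q)$; (iv) for every vertex $v$ of $Q$ the preimage $\phi^{-1}(v)$, as a subquiver of $Q'$, is a directed tree. A contraction is a minor morphism that sends no edge to $\star$. For $g\ge 0$ let $\mathbf{Quiver}_{\le g}$ be the category of non-empty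 connected quivers of genus at most $g$ and minor morphisms, $\mathbf{CQuiver}_{\le g}$ the category with the same objects and with contractions as morphisms, and $\mathbf{Digraph}_{\le g}$ the full subcategory of $\mathbf{Quiver}_{\le g}$ on the digraphs. A functor $\mathcal F\colon \mathbf C\to\mathbf D$ has property (F) if for every object $d$ of $\mathbf D$ there are finitely many objects $c_1,\dots,c_n$ of $\mathbf C$ and morphisms $\delta_i\colon d\to\mathcal F(c_i)$ such that every morphism $\delta\colon d\to\mathcal F(c)$, with $c$ any object of $\mathbf C$, equals $\mathcal F(\gamma)\circ\delta_i$ for some $i$ and some $\gamma\colon c_i\to c$. For a functor $S\colon\mathbf C\to\mathbf{Set}$, let $|S|$ be the poset obtained from the preorder on $\bigsqcup_c S(c)$ given by $f\le f'$ (for $f\in S(c)$, $f'\in S(c')$) if $S(h)(f)=f'$ for some $h\colon c\to c'$; $S$ is orderable if one can choose a well-order on every $S(c)$ such that all maps $S(h)$ are strictly order-preserving. An essentially small category $\mathbf C$ is Gröbner if for every object $c$ the functor $S_c=\mathrm{Hom}_{\mathbf C}(c,-)$ is orderable and every infinite sequence $x_1,x_2,\dots$ in $|S_c|$ has indices $i<j$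 with $x_i\le x_j$. An essentially small category is quasi-Gröbner if there is an essentially surjective functor with property (F) to it from a Gröbner category. Theorem (weak categorical quiver minor theorem). For every integer $g\ge 0$, the categories $\mathbf{Quiver}_{\le g}^{\mathrm{op}}$, $\mathbf{CQuiver}_{\le g}^{\mathrm{op}}$ and $\mathbf{Digraph}_{\le g}^{\mathrm{op}}$ are quasi-Gröbner. -/

import Mathlib

open CategoryTheory

universe u v w

/-! ## Gröbner and quasi-Gröbner categories -/

namespace GrobnerCat

section

variable {C : Type u} [Category.{v} C]

/-- Property (F) of a functor. -/
def PropertyF {D : Type*} [Category* D] (F : C ⥤ D) : Prop :=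
  ∀ d : D, ∃ (n : ℕ) (c : Fin n → C) (δ : ∀ i, d ⟶ F.obj (c i)),
    ∀ (x : C) (f : d ⟶ F.obj x), ∃ (i : Fin n) (γ : c i ⟶ x), f = δ i ≫ F.map γ

/-- A set-valued functor is orderable: one can choose a well-order on every value such that all
induced maps are strictly order-preserving. -/
def Orderable (S : C ⥤ Type w) : Prop :=
  ∃ r : ∀ c : C, S.obj c → S.obj c → Prop,
    (∀ c, IsWellOrder (S.obj c) (r c)) ∧
    ∀ (c c' : C) (h : c ⟶ c') (x y : S.obj c), r c x y → r c' (S.map h x) (S.map h y)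

/-- The disjoint union of all the values of a set-valued functor. -/
def Total (S : C ⥤ Type w) : Type (max u w) := Σ c : C, S.obj c

/-- `f ≤ g` if and only if some morphism of `C` carries `f` to `g`. -/
instance (S : C ⥤ Type w) : Preorder (Total S) where
  le f g := ∃ h : f.1 ⟶ g.1, S.map h f.2 = g.2
  le_refl f := ⟨𝟙 _, by simp⟩
  le_trans f g k := by
    rintro ⟨a, ha⟩ ⟨b, hb⟩
    exact ⟨a ≫ b, by simp [ha, hb]⟩

/-- The poset `|S|` of a set-valued functor: the quotient of the union of its values by the
equivalence relation `f ≤ g ∧ g ≤ f`. -/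
abbrev Poset (S : C ⥤ Type w) : Type (max u w) := Antisymmetrization (Total S) (· ≤ ·)

end

/-- An essentially small category is Gröbner if every functor `Hom(c, -)` is orderable and has a
Noetherian poset (every infinite sequence `x` has `x i ≤ x j` for some `i < j`). -/
def IsGrobner (C : Type u) [Category.{v} C] : Prop :=
  EssentiallySmall.{v} C ∧
    ∀ c : C, Orderable (coyoneda.obj (Opposite.op c)) ∧
      WellQuasiOrderedLE (Poset (coyoneda.obj (Opposite.op c)))

/-- An essentially small category is quasi-Gröbner if it receives an essentially surjective functor
with property (F) from a Gröbner category. -/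
def IsQuasiGrobner (C : Type u) [Category.{v} C] : Prop :=
  EssentiallySmall.{v} C ∧
    ∃ (D : Type (v + 1)) (_ : Category.{v} D) (F : D ⥤ C),
      IsGrobner D ∧ F.EssSurj ∧ PropertyF F

end GrobnerCat

/-! ## Finite quivers and minor morphisms -/

/-- A finite quiver: finite sets of vertices and edges with source and target maps. -/
structure FinQuiver where
  V : Type u
  E : Type u
  [finV : Finite V]
  [finE : Finite E]
  src : E → V
  tgt : E → V

namespace FinQuiver

attribute [instance] FinQuiver.finV FinQuiver.finE

/-- Each edge is determined by its source and target. -/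
def IsDigraph (Q : FinQuiver.{u}) : Prop :=
  ∀ e e' : Q.E, Q.src e = Q.src e' → Q.tgt e = Q.tgt e' → e = e'

/-- The geometric realization is (non-empty and) connected: any two vertices are joined by a path
of edges, traversed in either direction. -/
def Connected (Q : FinQuiver.{u}) : Prop :=
  Nonempty Q.V ∧ ∀ x y : Q.V, Relation.EqvGen (fun a b => ∃ e, Q.src e = a ∧ Q.tgt e = b) x y

/-- The cellular boundary map of the geometric realization, whose 0-cells are the vertices and
whose 1-cells are the edges. -/
noncomputable def boundary (Q : FinQuiver.{u}) : (Q.E →₀ ℤ) →ₗ[ℤ] (Q.V →₀ ℤ) :=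
  Finsupp.linearCombination ℤ
    (fun e => Finsupp.single (Q.tgt e) (1 : ℤ) - Finsupp.single (Q.src e) (1 : ℤ))

/-- The first Betti number of the geometric realization. There are no cells of dimension 2, so its
first homology group is the group of 1-cycles. -/
noncomputable def genus (Q : FinQuiver.{u}) : ℕ := Module.finrank ℤ (LinearMap.ker Q.boundary)

/-- A directed tree: a connected quiver of genus zero. -/
def IsTree (Q : FinQuiver.{u}) : Prop := Q.Connected ∧ Q.genus = 0

/-- The disjoint union of the vertices, the edges and one extra point `⋆`. -/
inductive Cell (Q : FinQuiver.{u}) : Type u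
  | vertex (x : Q.V) : Cell Q
  | edge (e : Q.E) : Cell Q
  | star : Cell Q

open Cell

/-- Every edge that is not sent to `⋆` either is sent to the common image of its endpoints, or is
sent to an edge whose source and target are the images of its source and target. -/
def EdgeCompatible {P Q : FinQuiver.{u}} (φ : Cell P → Cell Q) : Prop :=
  ∀ e : P.E, φ (edge e) ≠ star →
    (∃ x, φ (edge e) = vertex x ∧ φ (vertex (P.src e)) = vertex x ∧
      φ (vertex (P.tgt e)) = vertex x) ∨
    (∃ f, φ (edge e) = edge f ∧ φ (vertex (P.src e)) = vertex (Q.src f) ∧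
      φ (vertex (P.tgt e)) = vertex (Q.tgt f))

theorem EdgeCompatible.ends {P Q : FinQuiver.{u}} {φ : Cell P → Cell Q} (h : EdgeCompatible φ)
    {e : P.E} {x : Q.V} (he : φ (edge e) = vertex x) :
    φ (vertex (P.src e)) = vertex x ∧ φ (vertex (P.tgt e)) = vertex x := by
  rcases h e (by simp [he]) with ⟨y, h1, h2, h3⟩ | ⟨f, h1, _⟩
  · rw [he] at h1
    exact ⟨h2.trans h1.symm, h3.trans h1.symm⟩
  · rw [he] at h1
    cases h1

theorem EdgeCompatible.ends' {P Q : FinQuiver.{u}} {φ : Cell P → Cell Q} (h : EdgeCompatible φ)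
    {e : P.E} {f : Q.E} (he : φ (edge e) = edge f) :
    φ (vertex (P.src e)) = vertex (Q.src f) ∧ φ (vertex (P.tgt e)) = vertex (Q.tgt f) := by
  rcases h e (by simp [he]) with ⟨y, h1, h2, h3⟩ | ⟨f, h1, h2, h3⟩
  · rw [he] at h1
    cases h1
  · rw [he] at h1
    cases h1
    exact ⟨h2, h3⟩

/-- The preimage of the vertex `x`, as a subquiver. -/
def fiber {P Q : FinQuiver.{u}} (φ : Cell P → Cell Q) (h : EdgeCompatible φ) (x : Q.V) :
    FinQuiver.{u} where
  V := {y : P.V // φ (vertex y) = vertex x}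
  E := {e : P.E // φ (edge e) = vertex x}
  src e := ⟨P.src e.1, (h.ends e.2).1⟩
  tgt e := ⟨P.tgt e.1, (h.ends e.2).2⟩

/-- A minor morphism of quivers. -/
@[ext]
structure MinorHom (P Q : FinQuiver.{u}) where
  toFun : Cell P → Cell Q
  image_vertices : toFun '' Set.range vertex = Set.range vertex
  map_star : toFun star = star
  compat : EdgeCompatible toFun
  bijOn_edges : Set.BijOn toFun (toFun ⁻¹' Set.range edge) (Set.range edge)
  isTree_fiber : ∀ x : Q.V, (fiber toFun compat x).IsTree

/-! ### Composition of minor morphisms -/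

theorem genus_eq_zero_iff (Q : FinQuiver.{u}) :
    Q.genus = 0 ↔ ∀ x, Q.boundary x = 0 → x = 0 := by
  unfold genus
  rw [Module.finrank_eq_zero_iff_of_free, Submodule.subsingleton_iff_eq_bot,
    LinearMap.ker_eq_bot']

theorem boundary_single (Q : FinQuiver.{u}) (e : Q.E) (a : ℤ) :
    Q.boundary (Finsupp.single e a) =
      a • (Finsupp.single (Q.tgt e) (1 : ℤ) - Finsupp.single (Q.src e) (1 : ℤ)) := by
  simp [boundary]

namespace MinorHom

theorem exists_vertex {P Q : FinQuiver.{u}} (φ : MinorHom P Q) (y : P.V) :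
    ∃ x, φ.toFun (vertex y) = vertex x := by
  have h : φ.toFun (vertex y) ∈ Set.range vertex := by
    rw [← φ.image_vertices]
    exact ⟨_, ⟨y, rfl⟩, rfl⟩
  obtain ⟨x, hx⟩ := h
  exact ⟨x, hx.symm⟩

theorem exists_lift {P Q : FinQuiver.{u}} (φ : MinorHom P Q) (f : Q.E) :
    ∃ e, φ.toFun (edge e) = edge f := by
  obtain ⟨c, hc, h⟩ := φ.bijOn_edges.surjOn ⟨f, rfl⟩
  cases c with
  | vertex y =>
    obtain ⟨x, hx⟩ := φ.exists_vertex y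
    rw [hx] at h
    cases h
  | edge e => exact ⟨e, h⟩
  | star =>
    rw [φ.map_star] at h
    cases h

theorem lift_unique {P Q : FinQuiver.{u}} (φ : MinorHom P Q) {e e' : P.E} {f : Q.E}
    (h : φ.toFun (edge e) = edge f) (h' : φ.toFun (edge e') = edge f) : e = e' := by
  have := φ.bijOn_edges.injOn (⟨f, h.symm⟩ : edge e ∈ φ.toFun ⁻¹' Set.range edge)
    (⟨f, h'.symm⟩ : edge e' ∈ φ.toFun ⁻¹' Set.range edge) (h.trans h'.symm)
  cases this
  rfl

/-- The identity. -/
def id (Q : FinQuiver.{u}) : MinorHom Q Q where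
  toFun c := c
  image_vertices := by simp
  map_star := rfl
  compat e _ := Or.inr ⟨e, rfl, rfl, rfl⟩
  bijOn_edges := Set.bijOn_id _
  isTree_fiber x := by
    refine ⟨⟨⟨⟨x, rfl⟩⟩, ?_⟩, ?_⟩
    · rintro ⟨a, ha⟩ ⟨b, hb⟩
      cases ha
      cases hb
      exact Relation.EqvGen.refl _
    · rw [genus_eq_zero_iff]
      intro z _
      ext ⟨e, he⟩
      cases he

section comp

variable {P Q R : FinQuiver.{u}} (φ : MinorHom P Q) (ψ : MinorHom Q R)

theorem comp_compat : EdgeCompatible (ψ.toFun ∘ φ.toFun) := by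
  intro e he
  have h0 : φ.toFun (edge e) ≠ star := fun h => he (by simp [h, ψ.map_star])
  rcases φ.compat e h0 with ⟨y, h1, h2, h3⟩ | ⟨f, h1, h2, h3⟩
  · obtain ⟨x, hx⟩ := ψ.exists_vertex y
    exact Or.inl ⟨x, by simp [h1, hx], by simp [h2, hx], by simp [h3, hx]⟩
  · simp only [Function.comp_apply, h1, h2, h3] at he ⊢
    exact ψ.compat f he

theorem comp_bijOn : Set.BijOn (ψ.toFun ∘ φ.toFun) ((ψ.toFun ∘ φ.toFun) ⁻¹' Set.range edge)
    (Set.range edge) := by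
  have key : ∀ c, (ψ.toFun ∘ φ.toFun) c ∈ Set.range edge → φ.toFun c ∈ Set.range edge := by
    rintro c ⟨f, hf⟩
    rw [Function.comp_apply] at hf
    cases h : φ.toFun c with
    | vertex y =>
      obtain ⟨x, hx⟩ := ψ.exists_vertex y
      rw [h, hx] at hf
      cases hf
    | edge e => exact ⟨e, rfl⟩
    | star =>
      rw [h, ψ.map_star] at hf
      cases hf
  refine ⟨fun c hc => hc, ?_, ?_⟩
  · intro c hc c' hc' h
    exact φ.bijOn_edges.injOn (key c hc) (key c' hc') (ψ.bijOn_edges.injOn hc hc' h)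
  · rintro _ ⟨f, rfl⟩
    obtain ⟨e, he⟩ := ψ.exists_lift f
    obtain ⟨d, hd⟩ := φ.exists_lift e
    have h : (ψ.toFun ∘ φ.toFun) (edge d) = edge f := by simp [hd, he]
    exact ⟨edge d, ⟨f, h.symm⟩, h⟩

theorem comp_connected (x : R.V) :
    (fiber (ψ.toFun ∘ φ.toFun) (comp_compat φ ψ) x).Connected := by
  set F := fiber (ψ.toFun ∘ φ.toFun) (comp_compat φ ψ) x with hF
  let rel : F.V → F.V → Prop := fun a b => ∃ e, F.src e = a ∧ F.tgt e = b
  have h1 : ∀ (y : Q.V) (hy : ψ.toFun (vertex y) = vertex x)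
      (a b : (fiber φ.toFun φ.compat y).V),
      Relation.EqvGen rel ⟨a.1, by simp [a.2, hy]⟩ ⟨b.1, by simp [b.2, hy]⟩ := by
    intro y hy a b
    induction (φ.isTree_fiber y).1.2 a b with
    | rel a b h =>
      obtain ⟨e, rfl, rfl⟩ := h
      exact Relation.EqvGen.rel _ _ ⟨⟨e.1, by simp [e.2, hy]⟩, rfl, rfl⟩
    | refl a => exact Relation.EqvGen.refl _
    | symm a b _ ih => exact ih.symm _ _
    | trans a b c _ _ ih ih' => exact ih.trans _ _ _ ih'
  have h2 : ∀ (y z : (fiber ψ.toFun ψ.compat x).V) (a b : F.V),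
      φ.toFun (vertex a.1) = vertex y.1 → φ.toFun (vertex b.1) = vertex z.1 →
      Relation.EqvGen rel a b := by
    intro y z
    induction (ψ.isTree_fiber x).1.2 y z with
    | rel y z h =>
      obtain ⟨f, rfl, rfl⟩ := h
      intro a b ha hb
      obtain ⟨e, he⟩ := φ.exists_lift f.1
      obtain ⟨hs, ht⟩ := φ.compat.ends' he
      let e' : F.E := ⟨e, by simp [he, f.2]⟩
      have s1 : Relation.EqvGen rel a (F.src e') :=
        h1 (Q.src f.1) (ψ.compat.ends f.2).1 ⟨a.1, ha⟩ ⟨P.src e, hs⟩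
      have s2 : Relation.EqvGen rel (F.tgt e') b :=
        h1 (Q.tgt f.1) (ψ.compat.ends f.2).2 ⟨P.tgt e, ht⟩ ⟨b.1, hb⟩
      exact (s1.trans _ _ _ (Relation.EqvGen.rel _ _ ⟨e', rfl, rfl⟩)).trans _ _ _ s2
    | refl y => exact fun a b ha hb => h1 y.1 y.2 ⟨a.1, ha⟩ ⟨b.1, hb⟩
    | symm y z _ ih => exact fun a b ha hb => (ih b a hb ha).symm _ _
    | trans y z t _ _ ih ih' =>
      intro a b ha hb
      obtain ⟨⟨c, hc⟩⟩ := (φ.isTree_fiber z.1).1.1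
      have hc' : (ψ.toFun ∘ φ.toFun) (vertex c) = vertex x := by simp [hc, z.2]
      exact (ih a ⟨c, hc'⟩ ha hc).trans _ _ _ (ih' ⟨c, hc'⟩ b hc hb)
  have h3 : ∀ a : F.V, ∃ y : (fiber ψ.toFun ψ.compat x).V, φ.toFun (vertex a.1) = vertex y.1 := by
    intro a
    obtain ⟨y, hy⟩ := φ.exists_vertex a.1
    refine ⟨⟨y, ?_⟩, hy⟩
    rw [← hy]
    exact a.2
  refine ⟨?_, ?_⟩
  · obtain ⟨⟨y, hy⟩⟩ := (ψ.isTree_fiber x).1.1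
    obtain ⟨⟨c, hc⟩⟩ := (φ.isTree_fiber y).1.1
    exact ⟨⟨c, by simp [hc, hy]⟩⟩
  · intro a b
    obtain ⟨y, hy⟩ := h3 a
    obtain ⟨z, hz⟩ := h3 b
    exact h2 y z a b hy hz

open Classical in
theorem comp_genus (x : R.V) :
    (fiber (ψ.toFun ∘ φ.toFun) (comp_compat φ ψ) x).genus = 0 := by
  set F := fiber (ψ.toFun ∘ φ.toFun) (comp_compat φ ψ) x with hF
  rw [genus_eq_zero_iff]
  intro z hz
  -- images of vertices and edges in the fibre of `ψ`
  have hv : ∀ a : F.V, ∃ y : (fiber ψ.toFun ψ.compat x).V,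
      φ.toFun (vertex a.1) = vertex y.1 := by
    intro a
    obtain ⟨y, hy⟩ := φ.exists_vertex a.1
    refine ⟨⟨y, ?_⟩, hy⟩
    rw [← hy]
    exact a.2
  choose p hp using hv
  let T := fiber ψ.toFun ψ.compat x
  let pE : (F.E →₀ ℤ) →ₗ[ℤ] (T.E →₀ ℤ) := Finsupp.linearCombination ℤ (fun e =>
    if h : ∃ f : T.E, φ.toFun (edge e.1) = edge f.1 then Finsupp.single h.choose (1 : ℤ) else 0)
  let pV : (F.V →₀ ℤ) →ₗ[ℤ] (T.V →₀ ℤ) := Finsupp.linearCombination ℤ (fun a =>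
    Finsupp.single (p a) (1 : ℤ))
  have pE_single : ∀ (e : F.E) (f : T.E), φ.toFun (edge e.1) = edge f.1 →
      pE (Finsupp.single e 1) = Finsupp.single f 1 := by
    intro e f hf
    have h : ∃ f : T.E, φ.toFun (edge e.1) = edge f.1 := ⟨f, hf⟩
    have h' : h.choose = f := by
      have := h.choose_spec.symm.trans hf
      exact Subtype.ext (by simpa using this)
    simp only [pE, Finsupp.linearCombination_single, dif_pos h, h', one_smul]
  have pE_single' : ∀ (e : F.E), (¬ ∃ f : T.E, φ.toFun (edge e.1) = edge f.1) →
      pE (Finsupp.single e 1) = 0 := by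
    intro e h
    simp only [pE, Finsupp.linearCombination_single, dif_neg h, smul_zero]
  have cases_edge : ∀ e : F.E, (∃ f : T.E, φ.toFun (edge e.1) = edge f.1) ∨
      ∃ y : Q.V, φ.toFun (edge e.1) = vertex y := by
    intro e
    have he : ψ.toFun (φ.toFun (edge e.1)) = vertex x := e.2
    cases h : φ.toFun (edge e.1) with
    | vertex y => exact Or.inr ⟨y, rfl⟩
    | edge f => exact Or.inl ⟨⟨f, by rw [← he, h]⟩, rfl⟩
    | star =>
      rw [h, ψ.map_star] at he
      cases he
  have comm1 : T.boundary ∘ₗ pE = pV ∘ₗ F.boundary := by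
    refine Finsupp.lhom_ext' fun e => LinearMap.ext_ring ?_
    simp only [LinearMap.coe_comp, Function.comp_apply, Finsupp.lsingle_apply]
    rw [boundary_single, one_smul, map_sub]
    simp only [pV, Finsupp.linearCombination_single, one_smul]
    rcases cases_edge e with ⟨f, hf⟩ | ⟨y, hy⟩
    · rw [pE_single e f hf, boundary_single, one_smul]
      obtain ⟨hs, ht⟩ := φ.compat.ends' hf
      have e1 : p (F.tgt e) = T.tgt f := by
        exact Subtype.ext (Cell.vertex.inj ((hp (F.tgt e)).symm.trans ht))
      have e2 : p (F.src e) = T.src f := by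
        exact Subtype.ext (Cell.vertex.inj ((hp (F.src e)).symm.trans hs))
      rw [e1, e2]
    · rw [pE_single' e (by rintro ⟨f, hf⟩; rw [hy] at hf; cases hf), map_zero]
      obtain ⟨hs, ht⟩ := φ.compat.ends hy
      have e1 : p (F.tgt e) = p (F.src e) := by
        have h1 := (hp (F.tgt e)).symm.trans ht
        have h2 := (hp (F.src e)).symm.trans hs
        have := h1.trans h2.symm
        exact Subtype.ext (by simp_all)
      rw [e1, sub_self]
  have hpz : pE z = 0 := by
    have h : T.boundary (pE z) = 0 := by
      have := LinearMap.congr_fun comm1 z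
      simp only [LinearMap.coe_comp, Function.comp_apply, hz, map_zero] at this
      exact this
    exact (genus_eq_zero_iff T).1 (ψ.isTree_fiber x).2 _ h
  -- `z` vanishes on the edges that are not contracted by `φ`
  have hz1 : ∀ (e : F.E) (f : T.E), φ.toFun (edge e.1) = edge f.1 → z e = 0 := by
    intro e f hf
    have h : Finsupp.lapply f ∘ₗ pE = Finsupp.lapply e := by
      refine Finsupp.lhom_ext' fun d => LinearMap.ext_ring ?_
      simp only [LinearMap.coe_comp, Function.comp_apply, Finsupp.lsingle_apply,
        Finsupp.lapply_apply]
      by_cases hd : ∃ f' : T.E, φ.toFun (edge d.1) = edge f'.1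
      · obtain ⟨f', hf'⟩ := hd
        rw [pE_single d f' hf']
        by_cases hde : d = e
        · subst hde
          have : f' = f := by
            have := hf'.symm.trans hf
            exact Subtype.ext (by simpa using this)
          simp [this]
        · have : f' ≠ f := by
            rintro rfl
            exact hde (Subtype.ext (φ.lift_unique hf' hf))
          simp [this, hde]
      · rw [pE_single' d hd]
        have hde : d ≠ e := by
          rintro rfl
          exact hd ⟨f, hf⟩
        simp [hde]
    have := LinearMap.congr_fun h z
    simp only [LinearMap.coe_comp, Function.comp_apply, hpz, map_zero, Finsupp.lapply_apply] at this
    exact this.symm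
  ext e
  rw [Finsupp.zero_apply]
  rcases cases_edge e with ⟨f, hf⟩ | ⟨y, hy⟩
  · exact hz1 e f hf
  -- restriction to the fibre of `φ` over `y`
  let K := fiber φ.toFun φ.compat y
  let qE : (F.E →₀ ℤ) →ₗ[ℤ] (K.E →₀ ℤ) := Finsupp.linearCombination ℤ (fun e =>
    if h : φ.toFun (edge e.1) = vertex y then Finsupp.single (⟨e.1, h⟩ : K.E) (1 : ℤ) else 0)
  let qV : (F.V →₀ ℤ) →ₗ[ℤ] (K.V →₀ ℤ) := Finsupp.linearCombination ℤ (fun a =>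
    if h : φ.toFun (vertex a.1) = vertex y then Finsupp.single (⟨a.1, h⟩ : K.V) (1 : ℤ) else 0)
  have comm2 : ∀ d : F.E, d ∈ z.support →
      K.boundary (qE (Finsupp.single d 1)) = qV (F.boundary (Finsupp.single d 1)) := by
    intro d hd
    rw [boundary_single, one_smul, map_sub]
    simp only [qV, qE, Finsupp.linearCombination_single, one_smul]
    rcases cases_edge d with ⟨f, hf⟩ | ⟨t, ht⟩
    · exact absurd (hz1 d f hf) (Finsupp.mem_support_iff.1 hd)
    · obtain ⟨h1, h2⟩ := φ.compat.ends ht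
      by_cases hty : t = y
      · rw [hty] at ht h1 h2
        rw [dif_pos ht, dif_pos (show φ.toFun (vertex (F.tgt d).1) = _ from h2),
          dif_pos (show φ.toFun (vertex (F.src d).1) = _ from h1)]
        refine (boundary_single K _ _).trans ?_
        rw [one_smul]
        rfl
      · have g0 : ¬ φ.toFun (edge d.1) = vertex y := by rw [ht]; simpa using hty
        have g1 : ¬ φ.toFun (vertex (F.tgt d).1) = vertex y := by
          rw [show φ.toFun (vertex (F.tgt d).1) = _ from h2]; simpa using hty
        have g2 : ¬ φ.toFun (vertex (F.src d).1) = vertex y := by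
          rw [show φ.toFun (vertex (F.src d).1) = _ from h1]; simpa using hty
        rw [dif_neg g0, dif_neg g1, dif_neg g2, map_zero, sub_self]
  have hsum : z = ∑ d ∈ z.support, z d • Finsupp.single d (1 : ℤ) := by
    conv_lhs => rw [← Finsupp.sum_single z]
    exact Finset.sum_congr rfl fun d _ => by simp
  have hqz : qE z = 0 := by
    refine (genus_eq_zero_iff K).1 (φ.isTree_fiber y).2 _ ?_
    have h1 : K.boundary (qE z) = qV (F.boundary z) := by
      rw [hsum]
      simp only [map_sum, map_smul]
      exact Finset.sum_congr rfl fun d hd => by rw [comm2 d hd]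
    rw [h1, hz, map_zero]
  obtain ⟨k, hk⟩ : ∃ k : K.E, k.1 = e.1 := ⟨⟨e.1, hy⟩, rfl⟩
  have h : Finsupp.lapply k ∘ₗ qE = Finsupp.lapply e := by
    refine Finsupp.lhom_ext' fun d => LinearMap.ext_ring ?_
    simp only [LinearMap.coe_comp, Function.comp_apply, Finsupp.lsingle_apply,
      Finsupp.lapply_apply, qE, Finsupp.linearCombination_single, one_smul]
    by_cases hd : φ.toFun (edge d.1) = vertex y
    · rw [dif_pos hd]
      have hiff : (⟨d.1, hd⟩ : K.E) = k ↔ d = e :=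
        ⟨fun h => Subtype.ext ((congrArg Subtype.val h).trans hk),
          fun h => Subtype.ext ((congrArg Subtype.val h).trans hk.symm)⟩
      exact Finsupp.single_apply.trans ((if_congr hiff rfl rfl).trans Finsupp.single_apply.symm)
    · rw [dif_neg hd]
      have hde : d ≠ e := by
        rintro rfl
        exact hd hy
      simp [hde]
  have := LinearMap.congr_fun h z
  simp only [LinearMap.coe_comp, Function.comp_apply, hqz, map_zero, Finsupp.lapply_apply] at this
  exact this.symm

/-- Composition of minor morphisms is composition of functions. -/
def comp : MinorHom P R where
  toFun := ψ.toFun ∘ φ.toFun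
  image_vertices := by rw [Set.image_comp, φ.image_vertices, ψ.image_vertices]
  map_star := by simp [φ.map_star, ψ.map_star]
  compat := comp_compat φ ψ
  bijOn_edges := comp_bijOn φ ψ
  isTree_fiber x := ⟨comp_connected φ ψ x, comp_genus φ ψ x⟩

end comp

end MinorHom

/-! ### The categories -/

/-- Finite quivers and minor morphisms. -/
instance : Category.{u} FinQuiver.{u} where
  Hom := MinorHom
  id := MinorHom.id
  comp φ ψ := MinorHom.comp φ ψ

/-- The contractions: minor morphisms that delete no edge. -/
def contractions : MorphismProperty FinQuiver.{u} :=
  fun P _ φ => ∀ e : P.E, MinorHom.toFun φ (edge e) ≠ star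

instance : contractions.{u}.IsMultiplicative where
  id_mem Q e := fun h => by
    change edge e = star at h
    cases h
  comp_mem {P Q R} φ ψ hφ hψ := by
    intro e h
    change ψ.toFun (φ.toFun (edge e)) = star at h
    cases h' : MinorHom.toFun φ (edge e) with
    | vertex y =>
      obtain ⟨x, hx⟩ := MinorHom.exists_vertex ψ y
      rw [h', hx] at h
      cases h
    | edge f =>
      rw [h'] at h
      exact hψ f h
    | star => exact hφ e h'

/-- Connected quivers of genus at most `g`. -/
def genusLE (g : ℕ) : ObjectProperty FinQuiver.{u} := fun Q => Q.Connected ∧ Q.genus ≤ g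

/-- Connected quivers of genus at most `g`, and minor morphisms. -/
abbrev QuiverLE (g : ℕ) : Type (u + 1) := (genusLE.{u} g).FullSubcategory

/-- Connected quivers of genus at most `g`, and contractions. -/
abbrev CQuiverLE (g : ℕ) : Type (u + 1) :=
  ObjectProperty.FullSubcategory
    (fun Q : WideSubcategory contractions.{u} => genusLE g Q.obj)

/-- Connected digraphs of genus at most `g`, and minor morphisms. -/
abbrev DigraphLE (g : ℕ) : Type (u + 1) :=
  ObjectProperty.FullSubcategory
    (fun Q : FinQuiver.{u} => genusLE g Q ∧ Q.IsDigraph)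

end FinQuiver

/-! ## Planar forests and Kruskal's theorem -/

/-! Equip every quiver with a planar rooted spanning tree and a numbering of the other edges, of
which there are at most `g` (`Rig.extra_le_genus`). Take as morphisms the contractions that preserve
the order of the minima of fibres. The opposite of the resulting category `Rigid X` is Gröbner, and
forgetting the trees is the required functor.

Orderability: the Hom sets are finite and are ordered lexicographically. Precomposition respects
this order because it moves the first disagreement of two morphisms to the minimum of its fibre
(`Rigid.lexLT_comp`).

The Noetherian condition and property (F) both follow from `Rigid.exists_factorization`: among minor
morphisms `φ n : P n ⟶ d` from rigid quivers of bounded genus, some `φ j` is a rigid morphism `P j ⟶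
P i` followed by `φ i`, with `i < j`. To find it, label each node of the spanning tree by the
direction of its parent edge, the images in `d` of this edge and of the node, and the numbers of the
extra edges that start or end there. The labels are finite in number, so Kruskal's theorem
(`wellQuasiOrdered_isContractionOf`) contracts a later tree onto an earlier one, and the labels make
this a contraction of quivers (`Rig.isCollapse_of_labels`).

For compatibility with the maps to `d`, only tree edges that `φ j` contracts may be contracted. The
other tree edges are bounded in number in terms of `g` and `d`, since the fibres over the vertices
of `d` are connected (`Rig.card_criticalNode_le`). Hence their number may be taken equal for `i` and
`j`, and then the embedding of nodes hits all of them (`Rig.IsCollapse.comp_eq`). -/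

/-- Planar forests, coded as binary trees: a non-empty forest consists of the forest of children of
its first root and of the forest of the remaining trees. -/
inductive PlanarForest : Type
  | nil : PlanarForest
  | node (children siblings : PlanarForest) : PlanarForest

namespace PlanarForest

/-- The nodes of a planar forest. -/
inductive Node : PlanarForest → Type
  | root {l r : PlanarForest} : Node (node l r)
  | left {l r : PlanarForest} (x : Node l) : Node (node l r)
  | right {l r : PlanarForest} (x : Node r) : Node (node l r)

open Node

/-- The number of nodes. -/
def size : PlanarForest → ℕ
  | nil => 0
  | node l r => size l + size r + 1

/-- The parent of a node; the roots have the parent `none`, a virtual root of the forest. -/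
def parent : ∀ {S : PlanarForest}, S.Node → Option S.Node
  | _, root => none
  | _, left x => some ((parent x).elim root left)
  | _, right x => (parent x).map right

/-- The position of a node in the depth-first preorder. -/
def idx : ∀ {S : PlanarForest}, S.Node → ℕ
  | _, root => 0
  | _, left x => idx x + 1
  | _, right (l := l) x => idx x + size l + 1

/-- The position of a node or of the virtual root in the depth-first preorder. -/
def idxRoot {S : PlanarForest} : Option S.Node → ℕ
  | none => 0
  | some x => idx x + 1

theorem idx_lt_size {S : PlanarForest} (x : S.Node) : idx x < size S := by
  induction x <;> simp only [idx, size] <;> omega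

theorem idx_injective (S : PlanarForest) : Function.Injective (idx : S.Node → ℕ) := by
  intro x
  induction x with
  | root => intro y; cases y <;> simp [idx]
  | left x ih =>
    have := idx_lt_size x
    intro y h
    cases y with
    | root => simp [idx] at h
    | left y =>
      simp only [idx, Nat.add_right_cancel_iff] at h
      rw [ih h]
    | right y =>
      simp only [idx] at h
      omega
  | right x ih =>
    intro y h
    cases y with
    | root => simp [idx] at h
    | left y =>
      have := idx_lt_size y
      simp only [idx] at h
      omega
    | right y =>
      simp only [idx, Nat.add_right_cancel_iff] at h
      rw [ih h]

instance finite_node (S : PlanarForest) : Finite S.Node :=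
  Finite.of_injective (fun x => (⟨idx x, idx_lt_size x⟩ : Fin (size S)))
    fun _ _ h => idx_injective S (Fin.mk.inj h)

theorem idxRoot_injective (S : PlanarForest) :
    Function.Injective (idxRoot : Option S.Node → ℕ) := by
  rintro (_ | x) (_ | y) h
  · rfl
  · simp [idxRoot] at h
  · simp [idxRoot] at h
  · simp only [idxRoot, Nat.add_right_cancel_iff] at h
    rw [idx_injective S h]

/-- Preorder visits parents before children. This is the well-founded measure for every later
induction along the path to the virtual root. -/
theorem idxRoot_parent_lt {S : PlanarForest} (x : S.Node) :
    idxRoot (parent x) < idxRoot (some x) := by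
  induction x with
  | root => simp [parent, idxRoot]
  | left x ih =>
    cases h : parent x with
    | none => simp [parent, h, idxRoot, idx]
    | some y => simpa [parent, h, idxRoot, idx] using ih
  | right x ih =>
    cases h : parent x with
    | none => simp [parent, h, idxRoot]
    | some y => simpa [parent, h, idxRoot, idx] using ih

theorem parent_ne {S : PlanarForest} (x : S.Node) : parent x ≠ some x := fun h => by
  have := idxRoot_parent_lt x
  rw [h] at this
  exact lt_irrefl _ this

/-- A new leaf, placed before all other children of its parent. -/
theorem exists_addLeaf (S : PlanarForest) (p : Option S.Node) :
    ∃ (T : PlanarForest) (f : Option S.Node ≃ T.Node),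
      parent (f none) = p.map (fun y => f (some y)) ∧
      ∀ x, parent (f (some x)) = (parent x).map (fun y => f (some y)) := by
  have top : ∀ S : PlanarForest, ∃ (T : PlanarForest) (f : Option S.Node ≃ T.Node),
      parent (f none) = none ∧
      ∀ x, parent (f (some x)) = (parent x).map (fun y => f (some y)) := by
    intro S
    let f : Option S.Node ≃ (node nil S).Node :=
      { toFun := fun x => x.elim root right
        invFun := fun x => match x with
          | root => none
          | right x => some x
        left_inv := by rintro (_ | x) <;> rfl
        right_inv := by rintro (_ | x | x) <;> first | rfl | cases x }
    exact ⟨node nil S, f, rfl, fun x => rfl⟩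
  -- Here `p = none` stands for the first root itself, which plays the virtual root of `l`; so one
  -- construction serves both the `root` and the `left` case below.
  have inLeft : ∀ (l r : PlanarForest) (p : Option l.Node), (∃ (T : PlanarForest)
      (f : Option l.Node ≃ T.Node), parent (f none) = p.map (fun y => f (some y)) ∧
      ∀ x, parent (f (some x)) = (parent x).map (fun y => f (some y))) →
      ∃ (T : PlanarForest) (f : Option (node l r).Node ≃ T.Node),
      parent (f none) = some (f (some (p.elim root left))) ∧
      ∀ x, parent (f (some x)) = (parent x).map (fun y => f (some y)) := by
    rintro l r p ⟨T, f, h1, h2⟩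
    let F : Option (node l r).Node ≃ (node T r).Node :=
      { toFun := fun x => match x with
          | none => left (f none)
          | some root => root
          | some (left x) => left (f (some x))
          | some (right x) => right x
        invFun := fun x => match x with
          | root => some root
          | left y => (f.symm y).map left
          | right x => some (right x)
        left_inv := by rintro (_ | _ | x | x) <;> simp
        right_inv := by
          rintro (_ | x | x)
          · rfl
          · obtain ⟨y, rfl⟩ := f.surjective x
            cases y <;> simp
          · rfl }
    refine ⟨node T r, F, ?_, ?_⟩
    · change parent (left (f none)) = _
      rw [parent, h1]
      cases p <;> rfl
    · rintro (_ | x | x)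
      · rfl
      · change parent (left (f (some x))) = _
        rw [parent, parent, h2]
        cases parent x <;> rfl
      · change parent (right x) = _
        rw [parent, parent]
        cases parent x <;> rfl
  rcases p with _ | p
  · exact top S
  induction p with
  | @root l r => exact inLeft l r none (top l)
  | @left l r x ih => exact inLeft l r (some x) ih
  | @right l r x ih =>
    obtain ⟨T, f, h1, h2⟩ := ih
    let F : Option (node l r).Node ≃ (node l T).Node :=
      { toFun := fun x => match x with
          | none => right (f none)
          | some root => root
          | some (left x) => left x
          | some (right x) => right (f (some x))
        invFun := fun x => match x with
          | root => some root
          | left x => some (left x)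
          | right y => (f.symm y).map right
        left_inv := by rintro (_ | _ | x | x) <;> simp
        right_inv := by
          rintro (_ | x | x)
          · rfl
          · rfl
          · obtain ⟨y, rfl⟩ := f.surjective x
            cases y <;> simp }
    refine ⟨node l T, F, ?_, ?_⟩
    · change parent (right (f none)) = _
      rw [parent, h1]
      rfl
    · rintro (_ | x | x)
      · rfl
      · change parent (left x) = _
        rw [parent, parent]
        cases parent x <;> rfl
      · change parent (right (f (some x))) = _
        rw [parent, parent, h2]
        cases parent x <;> rfl

/-! ### Contractions of planar forests -/

/-- `m` and `ψ` describe a contraction of the forest `T` (with its virtual root) onto `S`: the nodes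
outside of the image of `m` are contracted to their parents. -/
structure IsContraction {S T : PlanarForest} (m : S.Node → T.Node)
    (ψ : Option T.Node → Option S.Node) : Prop where
  map_root : ψ none = none
  map_some : ∀ v, ψ (some (m v)) = some v
  map_parent : ∀ v, ψ (parent (m v)) = parent v
  map_of_notMem : ∀ x, (∀ v, m v ≠ x) → ψ (some x) = ψ (parent x)
  -- Not needed to contract quivers; it makes the induced contraction a morphism of rigid quivers.
  mono : ∀ u v, idx u < idx v → idx (m u) < idx (m v)

namespace IsContraction

variable {S T U : PlanarForest}

theorem refl (S : PlanarForest) : IsContraction (S := S) (fun x => x) (fun x => x) :=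
  ⟨rfl, fun _ => rfl, fun _ => rfl, fun x h => absurd rfl (h x), fun _ _ h => h⟩

theorem trans {m : S.Node → T.Node} {ψ : Option T.Node → Option S.Node} {m' : T.Node → U.Node}
    {ψ' : Option U.Node → Option T.Node} (h : IsContraction m ψ) (h' : IsContraction m' ψ') :
    IsContraction (fun x => m' (m x)) (fun x => ψ (ψ' x)) where
  map_root := by rw [h'.map_root, h.map_root]
  map_some v := by rw [h'.map_some, h.map_some]
  map_parent v := by rw [h'.map_parent, h.map_parent]
  map_of_notMem x hx := by
    by_cases hx' : ∃ y, m' y = x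
    · obtain ⟨y, rfl⟩ := hx'
      rw [h'.map_some, h'.map_parent]
      exact h.map_of_notMem y fun v hv => hx v (by rw [hv])
    · push Not at hx'
      rw [h'.map_of_notMem x hx']
  mono u v huv := h'.mono _ _ (h.mono _ _ huv)

theorem nil (T : PlanarForest) :
    IsContraction (S := PlanarForest.nil) (T := T) (fun x => nomatch x) (fun _ => none) where
  map_root := rfl
  map_some v := nomatch v
  map_parent v := nomatch v
  map_of_notMem _ _ := rfl
  mono u := nomatch u

/-- The roots of `r` are roots of the whole forest, so it suffices to absorb the first tree into the
virtual root. -/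
theorem right {l r : PlanarForest} {m : S.Node → r.Node} {ψ : Option r.Node → Option S.Node}
    (h : IsContraction m ψ) :
    IsContraction (T := node l r) (fun x => Node.right (m x))
      (fun x => match x with
        | some (Node.right x) => ψ (some x)
        | _ => none) where
  map_root := rfl
  map_some v := h.map_some v
  map_parent v := by
    rw [← h.map_parent, parent]
    cases parent (m v) with
    | none => exact h.map_root.symm
    | some y => rfl
  map_of_notMem x hx := by
    cases x with
    | root => rfl
    | left x =>
      rw [parent]
      cases parent x <;> rfl
    | right x =>
      rw [parent]
      change ψ (some x) = _
      rw [h.map_of_notMem x fun v hv => hx v (by rw [hv])]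
      cases parent x with
      | none => exact h.map_root
      | some y => rfl
  mono u v huv := by
    have := h.mono u v huv
    simp only [idx]
    omega

/-- The first root and all its sibling trees are absorbed into the virtual root, which makes the
roots of `l` lie directly below it. -/
theorem left {l r : PlanarForest} {m : S.Node → l.Node} {ψ : Option l.Node → Option S.Node}
    (h : IsContraction m ψ) :
    IsContraction (T := node l r) (fun x => Node.left (m x))
      (fun x => match x with
        | some (Node.left x) => ψ (some x)
        | _ => none) where
  map_root := rfl
  map_some v := h.map_some v
  map_parent v := by
    rw [← h.map_parent, parent]
    cases parent (m v) with
    | none => exact h.map_root.symm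
    | some y => rfl
  map_of_notMem x hx := by
    cases x with
    | root => rfl
    | right x =>
      rw [parent]
      cases parent x <;> rfl
    | left x =>
      rw [parent]
      change ψ (some x) = _
      rw [h.map_of_notMem x fun v hv => hx v (by rw [hv])]
      cases parent x with
      | none => exact h.map_root
      | some y => rfl
  mono u v huv := by
    have := h.mono u v huv
    simp only [idx]
    omega

/-- The map on nodes induced by maps of the children and of the siblings of the first root. -/
def mapNode {l r l' r' : PlanarForest} (m : l.Node → l'.Node) (n : r.Node → r'.Node) :
    (PlanarForest.node l r).Node → (PlanarForest.node l' r').Node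
  | root => root
  | Node.left x => Node.left (m x)
  | Node.right x => Node.right (n x)

/-- The two halves do not interact: the virtual root of `l` is identified with the first root, that
of `r` with the virtual root of the whole. Thanks to the binary coding, Kruskal's theorem needs only
pairs of forests here, and no comparison of sequences of subtrees. -/
theorem node {l r l' r' : PlanarForest} {m : l.Node → l'.Node} {ψ : Option l'.Node → Option l.Node}
    {n : r.Node → r'.Node} {χ : Option r'.Node → Option r.Node}
    (h : IsContraction m ψ) (k : IsContraction n χ) :
    IsContraction (mapNode m n)
      (fun x => match x with
        | none => none
        | some root => some root
        | some (Node.left x) => some ((ψ (some x)).elim root Node.left)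
        | some (Node.right x) => (χ (some x)).map Node.right) where
  map_root := rfl
  map_some v := by
    cases v <;> simp [mapNode, h.map_some, k.map_some]
  map_parent v := by
    cases v with
    | root => rfl
    | left v =>
      simp only [mapNode, parent]
      rw [← h.map_parent]
      cases parent (m v) with
      | none => simp [h.map_root]
      | some y => rfl
    | right v =>
      simp only [mapNode, parent]
      rw [← k.map_parent]
      cases parent (n v) with
      | none => simp [k.map_root]
      | some y => rfl
  map_of_notMem x hx := by
    cases x with
    | root => exact absurd rfl (hx root)
    | left x =>
      simp only [parent]
      rw [h.map_of_notMem x fun v hv => hx (Node.left v) (by simp [mapNode, hv])]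
      cases parent x with
      | none => simp [h.map_root]
      | some y => rfl
    | right x =>
      simp only [parent]
      rw [k.map_of_notMem x fun v hv => hx (Node.right v) (by simp [mapNode, hv])]
      cases parent x with
      | none => simp [k.map_root]
      | some y => rfl
  mono u v huv := by
    cases u with
    | root => cases v <;> simp [mapNode, idx] at huv ⊢
    | left u =>
      have := idx_lt_size (m u)
      cases v with
      | root => simp [idx] at huv
      | left v => simpa [mapNode, idx] using h.mono u v (by simpa [idx] using huv)
      | right v =>
        simp only [mapNode, idx]
        omega
    | right u =>
      cases v with
      | root => simp [idx] at huv
      | left v =>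
        have := idx_lt_size v
        simp only [idx] at huv
        omega
      | right v => simpa [mapNode, idx] using k.mono u v (by simpa [idx] using huv)

theorem injective {m : S.Node → T.Node} {ψ : Option T.Node → Option S.Node}
    (h : IsContraction m ψ) : Function.Injective m := fun u v huv => by
  have := h.map_some u
  rw [huv, h.map_some] at this
  exact (Option.some.inj this).symm

/-- A node outside the image of `m` has the same value of `ψ` as its parent. Walking up from `x`
therefore stays in the fibre over `v` until it meets `m v`, so `m v` is the first node of this
fibre. -/
theorem idx_le {m : S.Node → T.Node} {ψ : Option T.Node → Option S.Node}
    (h : IsContraction m ψ) (v : S.Node) (x : T.Node) (hx : ψ (some x) = some v) :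
    idx (m v) ≤ idx x := by
  induction hn : idx x using Nat.strong_induction_on generalizing x with
  | _ n ih =>
    subst hn
    by_cases hm : ∃ u, m u = x
    · obtain ⟨u, rfl⟩ := hm
      rw [h.map_some] at hx
      rw [Option.some.inj hx]
    · push Not at hm
      rw [h.map_of_notMem x hm] at hx
      have hlt := idxRoot_parent_lt x
      cases hp : parent x with
      | none =>
        rw [hp, h.map_root] at hx
        cases hx
      | some y =>
        rw [hp] at hx hlt
        simp only [idxRoot] at hlt
        have := ih (idx y) (by omega) y hx rfl
        omega

end IsContraction

/-- Planar forests with labelled nodes. -/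
abbrev Labelled (Λ : Type*) := Σ S : PlanarForest, (S.Node → Λ)

/-- One labelled forest is a contraction of another one. -/
def IsContractionOf {Λ : Type*} (F G : Labelled Λ) : Prop :=
  ∃ m ψ, IsContraction (S := F.1) (T := G.1) m ψ ∧ ∀ v, G.2 (m v) = F.2 v

instance {Λ : Type*} : IsPreorder (Labelled Λ) IsContractionOf where
  refl F := ⟨_, _, IsContraction.refl F.1, fun _ => rfl⟩
  trans := by
    rintro F G H ⟨m, ψ, h, e⟩ ⟨m', ψ', h', e'⟩
    exact ⟨_, _, h.trans h', fun v => by rw [e', e]⟩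

end PlanarForest

/-! ### Minimal bad sequences and Kruskal's theorem -/

open Set.PartiallyWellOrderedOn in
/-- In a minimal bad sequence, any selection of smaller predecessors of its terms is
well-quasi-ordered. -/
theorem Set.partiallyWellOrderedOn_range_of_isMinBadSeq {α : Type*} {r : α → α → Prop}
    (rk : α → ℕ) {f : ℕ → α} (hf : IsBadSeq r Set.univ f)
    (hmin : ∀ n, IsMinBadSeq r rk Set.univ n f) (t : ℕ → α) (ht : ∀ n, rk (t n) < rk (f n))
    (htr : ∀ n x, r x (t n) → r x (f n)) : (Set.range t).PartiallyWellOrderedOn r := by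
  rw [iff_forall_not_isBadSeq]
  rintro g ⟨hg, hbad⟩
  choose a ha using hg
  -- With `a k` minimal, all terms of `g` are predecessors of terms of `f` of index at least `a k`.
  -- So `f 0, …, f (a k - 1), g k, g (k + 1), …` is still bad, and it is smaller than `f` at its
  -- first change.
  obtain ⟨k, hk⟩ : ∃ k, ∀ j, a k ≤ a j := by
    obtain ⟨_, ⟨k, rfl⟩, h⟩ := WellFounded.has_min wellFounded_lt (Set.range a) ⟨_, ⟨0, rfl⟩⟩
    exact ⟨k, fun j => not_lt.1 (h _ ⟨j, rfl⟩)⟩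
  refine hmin (a k) (fun n => if n < a k then f n else g (n - a k + k)) ?_ ?_ ⟨fun _ => trivial, ?_⟩
  · intro m hm
    simp [hm]
  · simp only [lt_irrefl, if_false, Nat.sub_self, Nat.zero_add]
    rw [← ha k]
    exact ht _
  · intro i j hij
    by_cases hj : j < a k
    · simp only [hj, hij.trans hj, if_true]
      exact hf.2 i j hij
    · by_cases hi : i < a k
      · simp only [hi, hj, if_true, if_false]
        rw [← ha]
        intro h
        exact hf.2 _ _ (hi.trans_le (hk _)) (htr _ _ h)
      · simp only [hi, hj, if_false]
        exact hbad _ _ (by omega)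

namespace PlanarForest

/-- **Kruskal's theorem** for planar forests with finitely many labels. -/
theorem wellQuasiOrdered_isContractionOf (Λ : Type*) [Finite Λ] :
    WellQuasiOrdered (IsContractionOf (Λ := Λ)) := by
  rw [← Set.partiallyWellOrderedOn_univ_iff,
    Set.PartiallyWellOrderedOn.iff_not_exists_isMinBadSeq (fun F => size F.1)]
  rintro ⟨f, hf, hmin⟩
  have hne : ∀ n, ∃ (l r : PlanarForest) (ℓ : (node l r).Node → Λ), f n = ⟨node l r, ℓ⟩ := by
    intro n
    rcases h : f n with ⟨_ | ⟨l, r⟩, ℓ⟩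
    -- The empty forest is a contraction of every forest, so it cannot occur in a bad sequence.
    · refine absurd ?_ (hf.2 n (n + 1) n.lt_succ_self)
      rw [h]
      exact ⟨_, _, IsContraction.nil _, fun v => nomatch v⟩
    · exact ⟨l, r, ℓ, rfl⟩
  choose l r ℓ h using hne
  let L : ℕ → Labelled Λ := fun n => ⟨l n, fun x => ℓ n (Node.left x)⟩
  let R : ℕ → Labelled Λ := fun n => ⟨r n, fun x => ℓ n (Node.right x)⟩
  have hL : (Set.range L).PartiallyWellOrderedOn IsContractionOf := by
    refine Set.partiallyWellOrderedOn_range_of_isMinBadSeq _ hf hmin L ?_ ?_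
    · intro n
      simp only [h, L, size]
      omega
    · rintro n F ⟨m, ψ, hm, e⟩
      rw [h]
      exact ⟨_, _, hm.left, e⟩
  have hR : (Set.range R).PartiallyWellOrderedOn IsContractionOf := by
    refine Set.partiallyWellOrderedOn_range_of_isMinBadSeq _ hf hmin R ?_ ?_
    · intro n
      simp only [h, R, size]
      omega
    · rintro n F ⟨m, ψ, hm, e⟩
      rw [h]
      exact ⟨_, _, hm.right, e⟩
  -- Pass to a subsequence on which the children increase, then to one on which the siblings
  -- increase too; two root labels on it agree by finiteness.
  obtain ⟨s, hs⟩ := hL.exists_monotone_subseq (f := L) (fun n => ⟨n, rfl⟩)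
  obtain ⟨t, ht⟩ := hR.exists_monotone_subseq (f := fun n => R (s n)) (fun n => ⟨_, rfl⟩)
  obtain ⟨i, j, hij, e⟩ := Finite.wellQuasiOrdered (Eq : Λ → Λ → Prop)
    (fun n => ℓ (s (t n)) Node.root)
  refine hf.2 (s (t i)) (s (t j)) (s.strictMono (t.strictMono hij)) ?_
  obtain ⟨m, ψ, hm, em⟩ := hs (t i) (t j) (t.monotone hij.le)
  obtain ⟨n, χ, hn, en⟩ := ht i j hij.le
  rw [h, h]
  refine ⟨_, _, hm.node hn, fun v => ?_⟩
  cases v with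
  | root => exact e.symm
  | left v => exact em v
  | right v => exact en v

end PlanarForest

/-! ## Trees and counting edges -/

namespace FinQuiver

open Cell

theorem boundary_apply (Q : FinQuiver.{u}) (z : Q.E →₀ ℤ) (x : Q.V) :
    Q.boundary z x = ∑ e ∈ z.support,
      z e * (Finsupp.single (Q.tgt e) (1 : ℤ) x - Finsupp.single (Q.src e) (1 : ℤ) x) := by
  simp [boundary, Finsupp.linearCombination_apply, Finsupp.sum, Finsupp.finsetSum_apply]

/-- A quiver whose edges join the vertices other than a root to vertices of smaller rank, one edge
for each vertex, is a tree. -/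
theorem isTree_of_parent (Q : FinQuiver.{u}) (r : Q.V) (rk : Q.V → ℕ) (c o : Q.E → Q.V)
    (hc : Function.Injective c) (hlt : ∀ e, rk (o e) < rk (c e))
    (hend : ∀ e, (Q.src e = c e ∧ Q.tgt e = o e) ∨ (Q.src e = o e ∧ Q.tgt e = c e))
    (hsurj : ∀ x, x ≠ r → ∃ e, c e = x) : Q.IsTree := by
  refine ⟨⟨⟨r⟩, ?_⟩, ?_⟩
  · have key : ∀ x, Relation.EqvGen (fun a b => ∃ e, Q.src e = a ∧ Q.tgt e = b) x r := by
      intro x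
      induction hn : rk x using Nat.strong_induction_on generalizing x with
      | _ n ih =>
        subst hn
        by_cases hx : x = r
        · rw [hx]
          exact Relation.EqvGen.refl _
        · obtain ⟨e, rfl⟩ := hsurj x hx
          have h := ih _ (hlt e) _ rfl
          rcases hend e with ⟨h1, h2⟩ | ⟨h1, h2⟩
          · exact (Relation.EqvGen.rel _ _ ⟨e, h1, h2⟩).trans _ _ _ h
          · exact ((Relation.EqvGen.rel _ _ ⟨e, h1, h2⟩).symm).trans _ _ _ h
    exact fun x y => (key x).trans _ _ _ ((key y).symm)
  · rw [genus_eq_zero_iff]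
    intro z hz
    by_contra hne
    -- Among the edges in the support of a cycle, take one whose upper end `c e` has maximal rank.
    -- No other edge of the support touches this vertex, so the boundary there is the coefficient of
    -- `e` up to sign.
    obtain ⟨e, he, hmax⟩ := Finset.exists_max_image z.support (fun e => rk (c e))
      (Finsupp.support_nonempty_iff.2 hne)
    have h0 : Q.boundary z (c e) = 0 := by rw [hz]; rfl
    have hoc : ∀ e, o e ≠ c e := fun e h => by
      have := hlt e
      rw [h] at this
      exact lt_irrefl _ this
    rw [boundary_apply, Finset.sum_eq_single e] at h0
    · have hze := Finsupp.mem_support_iff.1 he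
      rcases hend e with ⟨h1, h2⟩ | ⟨h1, h2⟩
      · rw [h1, h2, Finsupp.single_eq_same, Finsupp.single_eq_of_ne (hoc e).symm] at h0
        simp at h0
        exact hze h0
      · rw [h1, h2, Finsupp.single_eq_same, Finsupp.single_eq_of_ne (hoc e).symm] at h0
        simp at h0
        exact hze h0
    · intro e' he' hee
      have h1 : c e ≠ c e' := fun h => hee (hc h.symm)
      have h2 : c e ≠ o e' := fun h => by
        have := hlt e'
        rw [← h] at this
        exact absurd (hmax e' he') (not_le.2 this)
      rcases hend e' with ⟨h3, h4⟩ | ⟨h3, h4⟩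
      · rw [h3, h4, Finsupp.single_eq_of_ne h1, Finsupp.single_eq_of_ne h2]
        simp
      · rw [h3, h4, Finsupp.single_eq_of_ne h1, Finsupp.single_eq_of_ne h2]
        simp
    · intro h
      exact absurd he h

/-- The underlying simple graph is still connected and loses only loops and multiplicities of edges.
-/
theorem Connected.card_le {Q : FinQuiver.{u}} (h : Q.Connected) :
    Nat.card Q.V ≤ Nat.card Q.E + 1 := by
  let G : SimpleGraph Q.V := SimpleGraph.fromRel (fun a b => ∃ e, Q.src e = a ∧ Q.tgt e = b)
  have hG : G.Connected := by
    have := h.1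
    refine ⟨fun x y => ?_⟩
    induction h.2 x y with
    | rel a b hab =>
      by_cases hne : a = b
      · rw [hne]
      · exact SimpleGraph.Adj.reachable ((SimpleGraph.fromRel_adj _ _ _).2 ⟨hne, Or.inl hab⟩)
    | refl a => exact SimpleGraph.Reachable.refl _
    | symm a b _ ih => exact ih.symm
    | trans a b c _ _ ih ih' => exact ih.trans ih'
  refine hG.card_vert_le_card_edgeSet_add_one.trans (Nat.add_le_add_right ?_ 1)
  have hE : ∀ s : G.edgeSet, ∃ e : Q.E, s(Q.src e, Q.tgt e) = s.1 := by
    rintro ⟨s, hs⟩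
    induction s with
    | _ a b =>
      rcases ((SimpleGraph.fromRel_adj _ _ _).1 (G.mem_edgeSet.1 hs)).2 with ⟨e, h1, h2⟩ | ⟨e, h1, h2⟩
      · exact ⟨e, by rw [h1, h2]⟩
      · exact ⟨e, by rw [h1, h2, Sym2.eq_swap]⟩
  choose f hf using hE
  exact Nat.card_le_card_of_injective f fun s t hst => Subtype.ext (by rw [← hf, ← hf, hst])

/-- Rank-nullity: the image of the boundary map lies in the kernel of the augmentation, which has
rank one less than the number of vertices. -/
theorem card_edges_lt (Q : FinQuiver.{u}) [Nonempty Q.V] :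
    Nat.card Q.E + 1 ≤ Nat.card Q.V + Q.genus := by
  let aug : (Q.V →₀ ℤ) →ₗ[ℤ] ℤ := Finsupp.linearCombination ℤ (fun _ => (1 : ℤ))
  have h1 := Submodule.finrank_quotient_add_finrank (LinearMap.ker Q.boundary)
  have h2 := Submodule.finrank_quotient_add_finrank (LinearMap.ker aug)
  rw [LinearEquiv.finrank_eq (LinearMap.quotKerEquivRange _)] at h1 h2
  have hsurj : LinearMap.range aug = ⊤ := by
    rw [LinearMap.range_eq_top]
    intro a
    exact ⟨Finsupp.single (Classical.arbitrary _) a, by simp [aug]⟩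
  have hle : LinearMap.range Q.boundary ≤ LinearMap.ker aug := by
    rw [LinearMap.range_le_ker_iff]
    refine Finsupp.lhom_ext' fun e => LinearMap.ext_ring ?_
    simp only [LinearMap.coe_comp, Function.comp_apply, Finsupp.lsingle_apply]
    rw [boundary_single]
    simp [aug]
  have h3 := Submodule.finrank_mono hle
  have := Fintype.ofFinite Q.V
  have := Fintype.ofFinite Q.E
  rw [hsurj, finrank_top, Module.finrank_self, Module.finrank_finsupp_self] at h2
  rw [Module.finrank_finsupp_self] at h1
  rw [Nat.card_eq_fintype_card, Nat.card_eq_fintype_card, genus]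
  omega

namespace MinorHom

/-- The number of edges that are not contracted by a minor morphism to a fixed quiver. -/
theorem card_not_contracted_add_le {P Q : FinQuiver.{u}} (φ : MinorHom P Q) :
    Nat.card {e : P.E // ∀ x, φ.toFun (edge e) ≠ vertex x} + Nat.card P.V ≤
      Nat.card P.E + Nat.card Q.V := by
  classical
  choose p hp using φ.exists_vertex
  have hV : Nat.card P.V = ∑ᶠ x : Q.V, Nat.card (fiber φ.toFun φ.compat x).V := by
    have := Fintype.ofFinite Q.V
    rw [finsum_eq_sum_of_fintype, ← Nat.card_sigma]
    exact Nat.card_congr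
      { toFun := fun y => ⟨p y, ⟨y, hp y⟩⟩
        invFun := fun y => y.2.1
        left_inv := fun _ => rfl
        right_inv := by
          rintro ⟨x, y, hy⟩
          obtain rfl : p y = x := Cell.vertex.inj ((hp y).symm.trans hy)
          rfl }
  have hE : Nat.card P.E = Nat.card {e : P.E // ∀ x, φ.toFun (edge e) ≠ vertex x} +
      ∑ᶠ x : Q.V, Nat.card (fiber φ.toFun φ.compat x).E := by
    have := Fintype.ofFinite Q.V
    rw [finsum_eq_sum_of_fintype, ← Nat.card_sigma, ← Nat.card_sum]
    refine (Nat.card_congr (Equiv.ofBijective (fun y : _ ⊕ _ => match y with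
      | Sum.inl e => e.1
      | Sum.inr e => e.2.1) ⟨?_, ?_⟩)).symm
    · rintro (⟨e, he⟩ | ⟨x, e, he⟩) (⟨e', he'⟩ | ⟨x', e', he'⟩) h
      · obtain rfl : e = e' := h
        rfl
      · obtain rfl : e = e' := h
        exact absurd he' (he _)
      · obtain rfl : e = e' := h
        exact absurd he (he' _)
      · obtain rfl : e = e' := h
        obtain rfl : x = x' := Cell.vertex.inj (he.symm.trans he')
        rfl
    · intro e
      by_cases he : ∃ x, φ.toFun (edge e) = vertex x
      · obtain ⟨x, hx⟩ := he
        exact ⟨Sum.inr ⟨x, e, hx⟩, rfl⟩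
      · push Not at he
        exact ⟨Sum.inl ⟨e, he⟩, rfl⟩
  -- The fibres partition the vertices and the contracted edges. Only their connectedness is used
  -- here: each has at most one vertex more than edges.
  have hle : ∑ᶠ x : Q.V, Nat.card (fiber φ.toFun φ.compat x).V ≤
      ∑ᶠ x : Q.V, Nat.card (fiber φ.toFun φ.compat x).E + Nat.card Q.V := by
    have := Fintype.ofFinite Q.V
    rw [finsum_eq_sum_of_fintype, finsum_eq_sum_of_fintype, Nat.card_eq_fintype_card,
      ← Finset.card_univ, Finset.card_eq_sum_ones, ← Finset.sum_add_distrib]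
    exact Finset.sum_le_sum fun x _ => (φ.isTree_fiber x).1.card_le
  omega

end MinorHom

end FinQuiver

/-! ## Quivers with a planar rooted spanning tree -/

namespace FinQuiver

open Cell PlanarForest

/-- A planar rooted spanning tree of a quiver, and a numbering of the edges outside of it. -/
structure Rig (Q : FinQuiver.{u}) where
  forest : PlanarForest
  extra : ℕ
  vert : Option forest.Node ≃ Q.V
  edge : forest.Node ⊕ Fin extra ≃ Q.E
  ends : ∀ p, (Q.src (edge (Sum.inl p)) = vert (some p) ∧
      Q.tgt (edge (Sum.inl p)) = vert (parent p)) ∨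
    (Q.src (edge (Sum.inl p)) = vert (parent p) ∧ Q.tgt (edge (Sum.inl p)) = vert (some p))

namespace Rig

variable {Q : FinQuiver.{u}} (t : Rig Q)

/-- The cells are ordered as follows: first `⋆`, then the vertices and the edges of the tree, both
in depth-first preorder, finally the edges outside of the tree. -/
def rank : Cell Q → ℕ ×ₗ ℕ
  | Cell.star => toLex (0, 0)
  | vertex x => toLex (1, idxRoot (t.vert.symm x))
  | Cell.edge e => match t.edge.symm e with
    | Sum.inl p => toLex (2, idx p)
    | Sum.inr i => toLex (3, i)

theorem rank_star : t.rank Cell.star = toLex (0, 0) := rfl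

theorem rank_vertex (a : Option t.forest.Node) :
    t.rank (Cell.vertex (t.vert a)) = toLex (1, idxRoot a) := by
  simp [rank]

theorem rank_tree (p : t.forest.Node) :
    t.rank (Cell.edge (t.edge (Sum.inl p))) = toLex (2, idx p) := by
  simp [rank]

theorem rank_extra (i : Fin t.extra) :
    t.rank (Cell.edge (t.edge (Sum.inr i))) = toLex (3, (i : ℕ)) := by
  simp [rank]

@[elab_as_elim]
theorem cell_cases {motive : Cell Q → Prop} (star : motive Cell.star)
    (vertex : ∀ a, motive (Cell.vertex (t.vert a)))
    (tree : ∀ p, motive (Cell.edge (t.edge (Sum.inl p))))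
    (extra : ∀ i, motive (Cell.edge (t.edge (Sum.inr i)))) (c : Cell Q) : motive c := by
  cases c with
  | star => exact star
  | vertex x =>
    obtain ⟨a, rfl⟩ := t.vert.surjective x
    exact vertex a
  | edge e =>
    obtain ⟨p | i, rfl⟩ := t.edge.surjective e
    · exact tree p
    · exact extra i

theorem rank_injective : Function.Injective t.rank := by
  intro c d h
  induction c using t.cell_cases with
  | star =>
    induction d using t.cell_cases <;>
      simp_all [rank_star, rank_vertex, rank_tree, rank_extra]
  | vertex a =>
    induction d using t.cell_cases <;>
      simp_all [rank_star, rank_vertex, rank_tree, rank_extra]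
    exact idxRoot_injective _ h
  | tree a =>
    induction d using t.cell_cases <;>
      simp_all [rank_star, rank_vertex, rank_tree, rank_extra]
    exact idx_injective _ h
  | extra a =>
    induction d using t.cell_cases <;>
      simp_all [rank_star, rank_vertex, rank_tree, rank_extra]
    exact Fin.ext h

theorem card_vertices : Nat.card Q.V = Nat.card t.forest.Node + 1 := by
  rw [← Nat.card_congr t.vert, Finite.card_option]

theorem card_edges : Nat.card Q.E = Nat.card t.forest.Node + t.extra := by
  rw [← Nat.card_congr t.edge, Nat.card_sum, Nat.card_fin]

/-- The tree has one edge fewer than there are vertices, so the Euler characteristic charges every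
other edge to the genus. This is how the genus bound enters. -/
theorem extra_le_genus : t.extra ≤ Q.genus := by
  have : Nonempty Q.V := ⟨t.vert none⟩
  have h := Q.card_edges_lt
  rw [t.card_vertices, t.card_edges] at h
  omega

/-! ### Existence of planar rooted spanning trees -/

/-- In a connected quiver every proper non-empty set of vertices is left by an edge. -/
theorem _root_.FinQuiver.Connected.exists_edge {Q : FinQuiver.{u}} (h : Q.Connected) (s : Set Q.V)
    (hs : s.Nonempty) (hs' : s ≠ Set.univ) :
    ∃ e, (Q.src e ∈ s ∧ Q.tgt e ∉ s) ∨ (Q.src e ∉ s ∧ Q.tgt e ∈ s) := by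
  by_contra hne
  push Not at hne
  obtain ⟨x, hx⟩ := hs
  refine hs' (Set.eq_univ_of_forall fun y => ?_)
  have key : ∀ a b, Relation.EqvGen (fun a b => ∃ e, Q.src e = a ∧ Q.tgt e = b) a b →
      (a ∈ s ↔ b ∈ s) := by
    intro a b hab
    induction hab with
    | rel a b hab =>
      obtain ⟨e, rfl, rfl⟩ := hab
      have := hne e
      tauto
    | refl a => rfl
    | symm a b _ ih => exact ih.symm
    | trans a b c _ _ ih ih' => exact ih.trans ih'
  exact (key x y (h.2 x y)).1 hx

/-- The tree grows by one leaf at a time: connectedness yields an edge leaving the set of vertices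
reached so far, and `exists_addLeaf` attaches its outer end. -/
theorem _root_.FinQuiver.Connected.exists_partialRig {Q : FinQuiver.{u}} (h : Q.Connected) (n : ℕ)
    (hn : n + 1 ≤ Nat.card Q.V) :
    ∃ (S : PlanarForest) (ve : Option S.Node → Q.V) (ed : S.Node → Q.E), Nat.card S.Node = n ∧
      Function.Injective ve ∧ Function.Injective ed ∧
      ∀ p, (Q.src (ed p) = ve (some p) ∧ Q.tgt (ed p) = ve (parent p)) ∨
        (Q.src (ed p) = ve (parent p) ∧ Q.tgt (ed p) = ve (some p)) := by
  induction n with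
  | zero =>
    obtain ⟨x⟩ := h.1
    have : IsEmpty PlanarForest.nil.Node := ⟨fun x => nomatch x⟩
    refine ⟨PlanarForest.nil, fun _ => x, fun p => isEmptyElim p, ?_, ?_, fun p => isEmptyElim p,
      fun p => isEmptyElim p⟩
    · exact Nat.card_of_isEmpty
    · rintro (_ | p) (_ | q) _
      · rfl
      · cases q
      · cases p
      · cases p
  | succ n ih =>
    obtain ⟨S, ve, ed, hc, hve, hed, hends⟩ := ih (by omega)
    have hne : Set.range ve ≠ Set.univ := by
      intro hu
      have h1 := Nat.card_congr (Equiv.ofBijective ve ⟨hve, Set.range_eq_univ.1 hu⟩)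
      rw [Finite.card_option] at h1
      omega
    obtain ⟨e, he⟩ := h.exists_edge (Set.range ve) ⟨_, ⟨none, rfl⟩⟩ hne
    have henot : ∀ p, ed p ≠ e := by
      rintro p rfl
      rcases hends p with ⟨h1, h2⟩ | ⟨h1, h2⟩ <;> rw [h1, h2] at he <;> simp at he
    obtain ⟨q, y, hy, hq⟩ : ∃ (q : Option S.Node) (y : Q.V), y ∉ Set.range ve ∧
        ((Q.src e = y ∧ Q.tgt e = ve q) ∨ (Q.src e = ve q ∧ Q.tgt e = y)) := by
      rcases he with ⟨⟨q, h1⟩, h2⟩ | ⟨h1, ⟨q, h2⟩⟩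
      · exact ⟨q, _, h2, Or.inr ⟨h1.symm, rfl⟩⟩
      · exact ⟨q, _, h1, Or.inl ⟨rfl, h2.symm⟩⟩
    obtain ⟨T, f, h1, h2⟩ := exists_addLeaf S q
    let ve' : Option T.Node → Q.V := fun a => match a with
      | none => ve none
      | some a => (f.symm a).elim y (fun b => ve (some b))
    let ed' : T.Node → Q.E := fun a => (f.symm a).elim e ed
    have hve' : ∀ b : Option S.Node, ve' (b.map (fun y => f (some y))) = ve b := by
      rintro (_ | b)
      · rfl
      · simp [ve']
    have hved : ∀ b, ve' (some (f b)) = b.elim y (fun b => ve (some b)) := fun b => by simp [ve']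
    have hed' : ∀ b, ed' (f b) = b.elim e ed := fun b => by simp [ed']
    refine ⟨T, ve', ed', ?_, ?_, ?_, ?_⟩
    · rw [← Nat.card_congr f, Finite.card_option, hc]
    · rintro (_ | a) (_ | b) hab
      · rfl
      · obtain ⟨b, rfl⟩ := f.surjective b
        rw [hved] at hab
        rcases b with _ | b
        · exact absurd ⟨_, hab⟩ hy
        · cases hve hab
      · obtain ⟨b, rfl⟩ := f.surjective a
        rw [hved] at hab
        rcases b with _ | b
        · exact absurd ⟨_, hab.symm⟩ hy
        · cases hve hab
      · obtain ⟨a, rfl⟩ := f.surjective a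
        obtain ⟨b, rfl⟩ := f.surjective b
        rw [hved, hved] at hab
        rcases a with _ | a <;> rcases b with _ | b
        · rfl
        · exact absurd ⟨_, hab.symm⟩ hy
        · exact absurd ⟨_, hab⟩ hy
        · rw [hve hab]
    · intro a b hab
      obtain ⟨a, rfl⟩ := f.surjective a
      obtain ⟨b, rfl⟩ := f.surjective b
      rw [hed', hed'] at hab
      rcases a with _ | a <;> rcases b with _ | b
      · rfl
      · exact absurd hab.symm (henot _)
      · exact absurd hab (henot _)
      · rw [hed hab]
    · intro a
      obtain ⟨a, rfl⟩ := f.surjective a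
      rw [hed', hved]
      rcases a with _ | a
      · rw [h1, hve']
        exact hq
      · rw [h2, hve']
        exact hends a

theorem _root_.FinQuiver.Connected.nonempty_rig {Q : FinQuiver.{u}} (h : Q.Connected) :
    Nonempty (Rig Q) := by
  classical
  have hpos : 0 < Nat.card Q.V := by
    have := h.1
    exact Nat.card_pos
  -- One vertex is reserved for the virtual root, hence the `- 1`.
  obtain ⟨S, ve, ed, hc, hve, hed, hends⟩ := h.exists_partialRig (Nat.card Q.V - 1) (by omega)
  have := Fintype.ofFinite Q.V
  have hbij : Function.Bijective ve := by
    refine (Nat.bijective_iff_injective_and_card ve).2 ⟨hve, ?_⟩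
    rw [Finite.card_option]
    omega
  refine ⟨⟨S, Nat.card {e // e ∉ Set.range ed}, Equiv.ofBijective ve hbij,
    (Equiv.sumCongr (Equiv.ofInjective ed hed) (Finite.equivFin {e // e ∉ Set.range ed}).symm).trans
      (Equiv.sumCompl (fun e => e ∈ Set.range ed)), ?_⟩⟩
  intro p
  exact hends p

end Rig

/-! ### The category of rigid quivers and its lexicographic orders -/

namespace MinorHom

theorem surjective {P Q : FinQuiver.{u}} (φ : MinorHom P Q) : Function.Surjective φ.toFun := by
  rintro (x | e | _)
  · obtain ⟨_, ⟨y, rfl⟩, h⟩ : vertex x ∈ φ.toFun '' Set.range vertex := by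
      rw [φ.image_vertices]
      exact ⟨x, rfl⟩
    exact ⟨_, h⟩
  · obtain ⟨e, he⟩ := φ.exists_lift e
    exact ⟨_, he⟩
  · exact ⟨_, φ.map_star⟩

end MinorHom

instance finite_cell (Q : FinQuiver.{u}) : Finite (Cell Q) :=
  Finite.of_surjective (fun c : Option (Q.V ⊕ Q.E) => match c with
    | none => Cell.star
    | some (Sum.inl x) => vertex x
    | some (Sum.inr e) => Cell.edge e) (by
    rintro (x | e | _)
    · exact ⟨some (Sum.inl x), rfl⟩
    · exact ⟨some (Sum.inr e), rfl⟩
    · exact ⟨none, rfl⟩)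

instance finite_minorHom (P Q : FinQuiver.{u}) : Finite (MinorHom P Q) :=
  Finite.of_injective (fun φ => φ.toFun) fun _ _ h => MinorHom.ext h

theorem toFun_comp {P Q R : FinQuiver.{u}} (φ : P ⟶ Q) (ψ : Q ⟶ R) (c : Cell P) :
    MinorHom.toFun (φ ≫ ψ) c = MinorHom.toFun ψ (MinorHom.toFun φ c) := rfl

/-- Quivers with property `X` and with a planar rooted spanning tree. -/
structure Rigid (X : FinQuiver.{u} → Prop) where
  quiver : FinQuiver.{u}
  prop : X quiver
  rig : Rig quiver

namespace Rigid

variable {X : FinQuiver.{u} → Prop}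

/-- Contractions that preserve the order of the minimal elements of the fibres. -/
@[ext]
structure Hom (P Q : Rigid X) where
  hom : P.quiver ⟶ Q.quiver
  isContraction : contractions hom
  mono : ∀ a b, Q.rig.rank a < Q.rig.rank b → ∃ c, hom.toFun c = a ∧
    ∀ d, hom.toFun d = b → P.rig.rank c < P.rig.rank d

instance : Category.{u} (Rigid X) where
  Hom := Hom
  id P := ⟨𝟙 _, contractions.id_mem _, fun a b h => ⟨a, rfl, fun d hd => by
    have hd : d = b := hd
    rwa [hd]⟩⟩
  comp {P Q R} φ ψ := ⟨φ.hom ≫ ψ.hom, contractions.comp_mem _ _ φ.isContraction ψ.isContraction, by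
    intro a b hab
    obtain ⟨c, hc, hc'⟩ := ψ.mono a b hab
    -- The witness that `φ.mono` gives depends on the second cell; the minimum of the fibre over `c`
    -- lies below all these witnesses and serves uniformly.
    obtain ⟨x, hx, hmin⟩ := Set.exists_min_image {x | φ.hom.toFun x = c} P.rig.rank
      (Set.toFinite _) (φ.hom.surjective c)
    refine ⟨x, ?_, fun d hd => ?_⟩
    · rw [toFun_comp, show φ.hom.toFun x = c from hx, hc]
    · obtain ⟨y, hy, hy'⟩ := φ.mono c (φ.hom.toFun d) (hc' _ hd)
      exact (hmin y hy).trans_lt (hy' d rfl)⟩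

theorem hom_ext {P Q : Rigid X} {φ ψ : P ⟶ Q} (h : ∀ c, φ.hom.toFun c = ψ.hom.toFun c) : φ = ψ :=
  Hom.ext (MinorHom.ext (funext h))

theorem comp_hom {P Q R : Rigid X} (φ : P ⟶ Q) (ψ : Q ⟶ R) : (φ ≫ ψ).hom = φ.hom ≫ ψ.hom := rfl

instance (P Q : Rigid X) : Finite (P ⟶ Q) :=
  Finite.of_injective (fun φ => MinorHom.toFun φ.hom) fun _ _ h => hom_ext (congrFun h)

/-- An endomorphism preserves the order, hence is the identity. -/
theorem eq_id {P : Rigid X} (φ : P ⟶ P) : φ = 𝟙 P := by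
  let _ : LinearOrder (Cell P.quiver) := LinearOrder.lift' P.rig.rank P.rig.rank_injective
  have hbij : Function.Bijective φ.hom.toFun :=
    Finite.injective_iff_bijective.1 (Finite.injective_iff_surjective.2 φ.hom.surjective)
  let e := Equiv.ofBijective _ hbij
  have hmono : StrictMono e.symm := by
    intro a b hab
    obtain ⟨c, hc, hc'⟩ := φ.mono a b hab
    have h1 : e.symm a = c := by
      rw [Equiv.symm_apply_eq]
      exact hc.symm
    rw [h1]
    exact hc' _ (e.apply_symm_apply b)
  have hmono' : StrictMono e := fun a b hab => by
    by_contra h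
    rw [not_lt] at h
    have := hmono.monotone h
    rw [e.symm_apply_apply, e.symm_apply_apply] at this
    exact absurd hab (not_lt.2 this)
  -- A strictly increasing self-map of a finite linear order never lowers an element; this applies
  -- to `e` and to its inverse.
  refine hom_ext fun c => le_antisymm ?_ ?_
  · have := hmono.le_apply (x := e c)
    rw [e.symm_apply_apply] at this
    exact this
  · exact hmono'.le_apply

/-- The lexicographic comparison of morphisms. -/
def lexLT {P Q : Rigid X} (φ ψ : P ⟶ Q) : Prop :=
  ∃ a, Q.rig.rank (φ.hom.toFun a) < Q.rig.rank (ψ.hom.toFun a) ∧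
    ∀ b, P.rig.rank b < P.rig.rank a → φ.hom.toFun b = ψ.hom.toFun b

/-- By finiteness of the Hom sets a strict linear order is enough, and distinct morphisms are
compared at the first cell where they differ. -/
theorem isWellOrder_lexLT (P Q : Rigid X) : IsWellOrder (P ⟶ Q) lexLT := by
  have htrans : ∀ φ ψ χ : P ⟶ Q, lexLT φ ψ → lexLT ψ χ → lexLT φ χ := by
    rintro φ ψ χ ⟨a, h1, h2⟩ ⟨b, h3, h4⟩
    rcases lt_trichotomy (P.rig.rank a) (P.rig.rank b) with h | h | h
    · exact ⟨a, by rwa [← h4 a h], fun c hc => (h2 c hc).trans (h4 c (hc.trans h))⟩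
    · obtain rfl := P.rig.rank_injective h
      exact ⟨a, h1.trans h3, fun c hc => (h2 c hc).trans (h4 c hc)⟩
    · exact ⟨b, by rwa [h2 b h], fun c hc => (h2 c (hc.trans h)).trans (h4 c hc)⟩
  have hirr : ∀ φ : P ⟶ Q, ¬ lexLT φ φ := fun φ ⟨_, h, _⟩ => lt_irrefl _ h
  have htri : ∀ φ ψ : P ⟶ Q, lexLT φ ψ ∨ φ = ψ ∨ lexLT ψ φ := by
    intro φ ψ
    by_cases h : φ = ψ
    · exact Or.inr (Or.inl h)
    · have hne : {a | φ.hom.toFun a ≠ ψ.hom.toFun a}.Nonempty := by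
        by_contra hemp
        refine h (hom_ext fun c => ?_)
        by_contra hc
        exact hemp ⟨c, hc⟩
      obtain ⟨a, ha, hmin⟩ := Set.exists_min_image _ P.rig.rank (Set.toFinite _) hne
      have hlt : ∀ b, P.rig.rank b < P.rig.rank a → φ.hom.toFun b = ψ.hom.toFun b := by
        intro b hb
        by_contra hc
        exact absurd (hmin b hc) (not_le.2 hb)
      rcases lt_trichotomy (Q.rig.rank (φ.hom.toFun a)) (Q.rig.rank (ψ.hom.toFun a)) with h | h | h
      · exact Or.inl ⟨a, h, hlt⟩
      · exact absurd (Q.rig.rank_injective h) ha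
      · exact Or.inr (Or.inr ⟨a, h, fun b hb => (hlt b hb).symm⟩)
  have i1 : IsTrans (P ⟶ Q) lexLT := ⟨htrans⟩
  have i2 : Std.Irrefl (lexLT (P := P) (Q := Q)) := ⟨hirr⟩
  have i3 : Std.Trichotomous (lexLT (P := P) (Q := Q)) := ⟨fun a b h h' => by
    rcases htri a b with h1 | h1 | h1
    · exact absurd h1 h
    · exact h1
    · exact absurd h1 h'⟩
  have i4 : IsWellFounded (P ⟶ Q) lexLT := ⟨Finite.wellFounded_of_trans_of_irrefl _⟩
  exact {}

/-- If `a` is the first cell where `φ` and `ψ` differ, the composites first differ at the minimum of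
the fibre of `χ` over `a`. Indeed, cells before this minimum are sent before `a`, since the minima
of fibres are ordered like their images; this is what `Hom.mono` is for. -/
theorem lexLT_comp {P Q R : Rigid X} (χ : R ⟶ P) {φ ψ : P ⟶ Q} (h : lexLT φ ψ) :
    lexLT (χ ≫ φ) (χ ≫ ψ) := by
  obtain ⟨a, h1, h2⟩ := h
  obtain ⟨x, hx, hmin⟩ := Set.exists_min_image {x | χ.hom.toFun x = a} R.rig.rank
    (Set.toFinite _) (χ.hom.surjective a)
  have hx : χ.hom.toFun x = a := hx
  refine ⟨x, ?_, fun b hb => ?_⟩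
  · simpa only [comp_hom, toFun_comp, hx] using h1
  · simp only [comp_hom, toFun_comp]
    by_cases hlt : P.rig.rank (χ.hom.toFun b) < P.rig.rank a
    · exact h2 _ hlt
    · rcases (not_lt.1 hlt).lt_or_eq with h | h
      · obtain ⟨y, hy, hy'⟩ := χ.mono _ _ h
        exact absurd ((hmin y hy).trans_lt (hy' b rfl)) hb.not_gt
      · exact absurd (hmin b (P.rig.rank_injective h).symm) (not_le.2 hb)

theorem orderable (P : (Rigid X)ᵒᵖ) : GrobnerCat.Orderable (coyoneda.obj (Opposite.op P)) :=
  ⟨fun _ φ ψ => lexLT φ.unop ψ.unop, fun c => by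
    have := isWellOrder_lexLT c.unop P.unop
    exact (RelEmbedding.isWellOrder (s := lexLT (P := c.unop) (Q := P.unop))
      ⟨⟨Quiver.Hom.unop, Quiver.Hom.unop_inj⟩, Iff.rfl⟩),
    fun _ _ χ _ _ h => lexLT_comp χ.unop h⟩

end Rigid

end FinQuiver

/-! ## Contractions of rigid quivers from contractions of planar forests -/

namespace FinQuiver

open Cell PlanarForest

namespace Rig

variable {P Q : FinQuiver.{u}}

open Classical in
/-- The map on cells induced by a contraction of the spanning trees. -/
noncomputable def collapse (s : Rig P) (t : Rig Q) (m : t.forest.Node → s.forest.Node)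
    (ψ : Option s.forest.Node → Option t.forest.Node) (hk : s.extra = t.extra) :
    Cell P → Cell Q
  | Cell.star => Cell.star
  | Cell.vertex x => Cell.vertex (t.vert (ψ (s.vert.symm x)))
  | Cell.edge e => match s.edge.symm e with
    | Sum.inl p => if h : ∃ q, m q = p then Cell.edge (t.edge (Sum.inl h.choose))
      else Cell.vertex (t.vert (ψ (some p)))
    | Sum.inr i => Cell.edge (t.edge (Sum.inr (Fin.cast hk i)))

/-- The compatibility of a contraction of the spanning trees with the directions of the edges and
with the ends of the edges outside of the trees. -/
structure IsCollapse (s : Rig P) (t : Rig Q) (m : t.forest.Node → s.forest.Node)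
    (ψ : Option s.forest.Node → Option t.forest.Node) (hk : s.extra = t.extra) : Prop where
  isContraction : IsContraction m ψ
  dir : ∀ p, P.src (s.edge (Sum.inl (m p))) = s.vert (some (m p)) ↔
    Q.src (t.edge (Sum.inl p)) = t.vert (some p)
  src : ∀ i, ψ (s.vert.symm (P.src (s.edge (Sum.inr i)))) =
    t.vert.symm (Q.src (t.edge (Sum.inr (Fin.cast hk i))))
  tgt : ∀ i, ψ (s.vert.symm (P.tgt (s.edge (Sum.inr i)))) =
    t.vert.symm (Q.tgt (t.edge (Sum.inr (Fin.cast hk i))))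

namespace IsCollapse

variable {s : Rig P} {t : Rig Q} {m : t.forest.Node → s.forest.Node}
  {ψ : Option s.forest.Node → Option t.forest.Node} {hk : s.extra = t.extra}

theorem collapse_star : collapse s t m ψ hk Cell.star = Cell.star := rfl

theorem collapse_vertex (a : Option s.forest.Node) :
    collapse s t m ψ hk (Cell.vertex (s.vert a)) = Cell.vertex (t.vert (ψ a)) := by
  simp [collapse]

theorem collapse_extra (i : Fin s.extra) :
    collapse s t m ψ hk (Cell.edge (s.edge (Sum.inr i))) =
      Cell.edge (t.edge (Sum.inr (Fin.cast hk i))) := by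
  simp [collapse]

theorem collapse_tree_of_notMem (p : s.forest.Node) (hp : ∀ q, m q ≠ p) :
    collapse s t m ψ hk (Cell.edge (s.edge (Sum.inl p))) = Cell.vertex (t.vert (ψ (some p))) := by
  simp [collapse, hp]

variable (h : IsCollapse s t m ψ hk)

include h

theorem collapse_tree (q : t.forest.Node) :
    collapse s t m ψ hk (Cell.edge (s.edge (Sum.inl (m q)))) = Cell.edge (t.edge (Sum.inl q)) := by
  have hq : ∃ q', m q' = m q := ⟨q, rfl⟩
  simp only [collapse, Equiv.symm_apply_apply, dif_pos hq]
  rw [h.isContraction.injective hq.choose_spec]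

theorem map_section (a : Option t.forest.Node) : ψ (a.map m) = a := by
  cases a with
  | none => exact h.isContraction.map_root
  | some q => exact h.isContraction.map_some q

theorem compat : EdgeCompatible (collapse s t m ψ hk) := by
  intro e _
  obtain ⟨p | i, rfl⟩ := s.edge.surjective e
  · by_cases hp : ∃ q, m q = p
    · obtain ⟨q, rfl⟩ := hp
      refine Or.inr ⟨_, h.collapse_tree q, ?_⟩
      rcases s.ends (m q) with ⟨h1, h2⟩ | ⟨h1, h2⟩
      -- `dir` selects the same alternative of `ends` in both trees; a mixed choice would make a
      -- node its own parent.
      · have h3 := (h.dir q).1 h1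
        rcases t.ends q with ⟨h4, h5⟩ | ⟨h4, h5⟩
        · rw [h1, h2, h4, h5, collapse_vertex, collapse_vertex, h.isContraction.map_some,
            h.isContraction.map_parent]
          exact ⟨rfl, rfl⟩
        · rw [h3] at h4
          exact absurd (t.vert.injective h4).symm (parent_ne q)
      · rcases t.ends q with ⟨h4, h5⟩ | ⟨h4, h5⟩
        · have h3 := (h.dir q).2 h4
          rw [h3] at h1
          exact absurd (s.vert.injective h1).symm (parent_ne (m q))
        · rw [h1, h2, h4, h5, collapse_vertex, collapse_vertex, h.isContraction.map_some,
            h.isContraction.map_parent]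
          exact ⟨rfl, rfl⟩
    · push Not at hp
      refine Or.inl ⟨_, collapse_tree_of_notMem p hp, ?_⟩
      have h3 := h.isContraction.map_of_notMem p hp
      rcases s.ends p with ⟨h1, h2⟩ | ⟨h1, h2⟩ <;>
        simp [h1, h2, collapse_vertex, h3]
  · refine Or.inr ⟨_, collapse_extra i, ?_, ?_⟩
    · rw [← s.vert.apply_symm_apply (P.src _), collapse_vertex, h.src, t.vert.apply_symm_apply]
    · rw [← s.vert.apply_symm_apply (P.tgt _), collapse_vertex, h.tgt, t.vert.apply_symm_apply]

/-- Apart from one base point, the lift of `a` along `m`, the vertices of a fibre are nodes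
contracted to a parent in the same fibre. Their parent edges are exactly the edges of the fibre, so
`isTree_of_parent` applies with preorder as the rank. -/
theorem isTree_fiber (x : Q.V) : (fiber (collapse s t m ψ hk) h.compat x).IsTree := by
  obtain ⟨a, rfl⟩ := t.vert.surjective x
  set F := fiber (collapse s t m ψ hk) h.compat (t.vert a)
  have hv : ∀ b, collapse s t m ψ hk (Cell.vertex (s.vert b)) = Cell.vertex (t.vert a) ↔ ψ b = a := by
    intro b
    rw [collapse_vertex]
    simp
  have he : ∀ e : F.E, ∃ p, e.1 = s.edge (Sum.inl p) ∧ (∀ q, m q ≠ p) ∧ ψ (some p) = a := by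
    rintro ⟨e, he⟩
    obtain ⟨p | i, rfl⟩ := s.edge.surjective e
    · refine ⟨p, rfl, ?_⟩
      by_cases hp : ∃ q, m q = p
      · obtain ⟨q, rfl⟩ := hp
        rw [h.collapse_tree] at he
        cases he
      · push Not at hp
        rw [collapse_tree_of_notMem p hp] at he
        exact ⟨hp, by simpa using he⟩
    · rw [collapse_extra] at he
      cases he
  choose p hp hm hψ using he
  have hpar : ∀ e, ψ (parent (p e)) = a := fun e => by
    rw [← h.isContraction.map_of_notMem _ (hm e), hψ]
  refine isTree_of_parent F ⟨s.vert (a.map m), (hv _).2 (h.map_section a)⟩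
    (fun y => idxRoot (s.vert.symm y.1)) (fun e => ⟨s.vert (some (p e)), (hv _).2 (hψ e)⟩)
    (fun e => ⟨s.vert (parent (p e)), (hv _).2 (hpar e)⟩) ?_ ?_ ?_ ?_
  · intro e e' hee
    have := s.vert.injective (congrArg Subtype.val hee)
    exact Subtype.ext (by rw [hp, hp, Option.some.inj this])
  · intro e
    simp only [Equiv.symm_apply_apply]
    exact idxRoot_parent_lt _
  · intro e
    have h1 : (F.src e).1 = P.src (s.edge (Sum.inl (p e))) := by rw [← hp]; rfl
    have h2 : (F.tgt e).1 = P.tgt (s.edge (Sum.inl (p e))) := by rw [← hp]; rfl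
    rcases s.ends (p e) with ⟨h3, h4⟩ | ⟨h3, h4⟩
    · exact Or.inl ⟨Subtype.ext (h1.trans h3), Subtype.ext (h2.trans h4)⟩
    · exact Or.inr ⟨Subtype.ext (h1.trans h3), Subtype.ext (h2.trans h4)⟩
  · rintro ⟨y, hy⟩ hne
    obtain ⟨b, rfl⟩ := s.vert.surjective y
    rw [hv] at hy
    subst hy
    rcases b with _ | b
    · refine absurd (Subtype.ext ?_) hne
      simp [h.isContraction.map_root]
    · by_cases hb : ∃ q, m q = b
      · obtain ⟨q, rfl⟩ := hb
        refine absurd (Subtype.ext ?_) hne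
        simp [h.isContraction.map_some]
      · push Not at hb
        let e : F.E := ⟨s.edge (Sum.inl b), collapse_tree_of_notMem b hb⟩
        refine ⟨e, Subtype.ext ?_⟩
        have := s.edge.injective (hp e)
        exact congrArg (fun q => s.vert (some q)) (Sum.inl.inj this).symm

/-- The minor morphism induced by a contraction of the spanning trees. -/
noncomputable def minorHom : MinorHom P Q where
  toFun := collapse s t m ψ hk
  image_vertices := by
    apply Set.Subset.antisymm
    · rintro _ ⟨_, ⟨x, rfl⟩, rfl⟩
      exact ⟨_, rfl⟩
    · rintro _ ⟨x, rfl⟩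
      obtain ⟨a, rfl⟩ := t.vert.surjective x
      exact ⟨_, ⟨s.vert (a.map m), rfl⟩, by rw [collapse_vertex, h.map_section]⟩
  map_star := rfl
  compat := h.compat
  bijOn_edges := by
    refine ⟨fun c hc => hc, ?_, ?_⟩
    · have key : ∀ c ∈ collapse s t m ψ hk ⁻¹' Set.range Cell.edge,
          (∃ q, c = Cell.edge (s.edge (Sum.inl (m q)))) ∨
          ∃ i, c = Cell.edge (s.edge (Sum.inr i)) := by
        rintro c ⟨f, hf⟩
        induction c using s.cell_cases with
        | star => cases hf
        | vertex a => cases hf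
        | tree p =>
          by_cases hp : ∃ q, m q = p
          · obtain ⟨q, rfl⟩ := hp
            exact Or.inl ⟨q, rfl⟩
          · push Not at hp
            rw [collapse_tree_of_notMem p hp] at hf
            cases hf
        | extra i => exact Or.inr ⟨i, rfl⟩
      intro c hc c' hc' hcc
      rcases key c hc with ⟨q, rfl⟩ | ⟨i, rfl⟩ <;> rcases key c' hc' with ⟨q', rfl⟩ | ⟨i', rfl⟩ <;>
        simp only [h.collapse_tree, collapse_extra, Cell.edge.injEq, EmbeddingLike.apply_eq_iff_eq,
          reduceCtorEq, Sum.inl.injEq, Sum.inr.injEq] at hcc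
      · rw [hcc]
      · rw [Fin.cast_injective hk hcc]
    · rintro _ ⟨f, rfl⟩
      obtain ⟨q | i, rfl⟩ := t.edge.surjective f
      · exact ⟨_, ⟨_, (h.collapse_tree q).symm⟩, h.collapse_tree q⟩
      · have := collapse_extra (s := s) (t := t) (m := m) (ψ := ψ) (hk := hk) (Fin.cast hk.symm i)
        exact ⟨_, ⟨_, this.symm⟩, this⟩
  isTree_fiber := h.isTree_fiber

theorem collapse_ne_star {c : Cell P} (hc : c ≠ Cell.star) :
    collapse s t m ψ hk c ≠ Cell.star := by
  induction c using s.cell_cases with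
  | star => exact absurd rfl hc
  | vertex a => simp [collapse_vertex]
  | tree p =>
    by_cases hp : ∃ q, m q = p
    · obtain ⟨q, rfl⟩ := hp
      simp [h.collapse_tree]
    · push Not at hp
      simp [collapse_tree_of_notMem p hp]
  | extra i => simp [collapse_extra]

theorem idxRoot_le (a : Option s.forest.Node) : idxRoot ((ψ a).map m) ≤ idxRoot a := by
  cases a with
  | none => simp [h.isContraction.map_root, idxRoot]
  | some x =>
    cases hx : ψ (some x) with
    | none => simp [idxRoot]
    | some v => simpa [idxRoot] using h.isContraction.idx_le v x hx

theorem idxRoot_lt {a b : Option t.forest.Node} (hab : idxRoot a < idxRoot b) :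
    idxRoot (a.map m) < idxRoot (b.map m) := by
  cases b with
  | none => simp [idxRoot] at hab
  | some v =>
    cases a with
    | none => simp [idxRoot]
    | some u =>
      simp only [idxRoot, add_lt_add_iff_right, Option.map_some] at hab ⊢
      exact h.isContraction.mono u v hab

/-- The lift of a vertex along `m` is the minimum of its fibre: `idxRoot_le` compares it with the
other vertices, and contracted edges rank after all vertices. The fibres over the other cells are
singletons, and lifting respects the order. -/
theorem rank_lt (a b : Cell Q) (hab : t.rank a < t.rank b) :
    ∃ c, collapse s t m ψ hk c = a ∧
      ∀ d, collapse s t m ψ hk d = b → s.rank c < s.rank d := by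
  induction a using t.cell_cases with
  | star =>
    refine ⟨Cell.star, rfl, fun d hd => ?_⟩
    induction d using s.cell_cases with
    | star =>
      rw [← hd] at hab
      exact absurd hab (lt_irrefl _)
    | vertex a => simp [rank_star, rank_vertex, Prod.Lex.toLex_lt_toLex]
    | tree p => simp [rank_star, rank_tree, Prod.Lex.toLex_lt_toLex]
    | extra p => simp [rank_star, rank_extra, Prod.Lex.toLex_lt_toLex]
  | vertex a =>
    refine ⟨Cell.vertex (s.vert (a.map m)), by rw [collapse_vertex, h.map_section], fun d hd => ?_⟩
    induction d using s.cell_cases with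
    | star =>
      rw [← hd] at hab
      simp [collapse_star, rank_star, rank_vertex, Prod.Lex.toLex_lt_toLex] at hab
    | vertex d =>
      rw [collapse_vertex] at hd
      rw [← hd] at hab
      simp only [rank_vertex, Prod.Lex.toLex_lt_toLex, lt_irrefl, true_and, false_or] at hab ⊢
      exact (h.idxRoot_lt hab).trans_le (h.idxRoot_le d)
    | tree p => simp [rank_vertex, rank_tree, Prod.Lex.toLex_lt_toLex]
    | extra p => simp [rank_vertex, rank_extra, Prod.Lex.toLex_lt_toLex]
  | tree p =>
    refine ⟨_, h.collapse_tree p, fun d hd => ?_⟩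
    induction d using s.cell_cases with
    | star =>
      rw [← hd] at hab
      simp [collapse_star, rank_star, rank_tree, Prod.Lex.toLex_lt_toLex] at hab
    | vertex d =>
      rw [← hd] at hab
      simp [collapse_vertex, rank_vertex, rank_tree, Prod.Lex.toLex_lt_toLex] at hab
    | tree q =>
      by_cases hq : ∃ q', m q' = q
      · obtain ⟨q, rfl⟩ := hq
        rw [← hd] at hab
        simp only [h.collapse_tree, rank_tree, Prod.Lex.toLex_lt_toLex, lt_irrefl, true_and,
          false_or] at hab ⊢
        exact h.isContraction.mono _ _ hab
      · push Not at hq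
        rw [← hd] at hab
        simp [collapse_tree_of_notMem q hq, rank_vertex, rank_tree,
          Prod.Lex.toLex_lt_toLex] at hab
    | extra q => simp [rank_tree, rank_extra, Prod.Lex.toLex_lt_toLex]
  | extra i =>
    obtain ⟨i, rfl⟩ : ∃ j, Fin.cast hk j = i := ⟨Fin.cast hk.symm i, rfl⟩
    refine ⟨_, collapse_extra i, fun d hd => ?_⟩
    induction d using s.cell_cases with
    | star =>
      rw [← hd] at hab
      simp [collapse_star, rank_star, rank_extra, Prod.Lex.toLex_lt_toLex] at hab
    | vertex d =>
      rw [← hd] at hab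
      simp [collapse_vertex, rank_vertex, rank_extra, Prod.Lex.toLex_lt_toLex] at hab
    | tree q =>
      by_cases hq : ∃ q', m q' = q
      · obtain ⟨q, rfl⟩ := hq
        rw [← hd] at hab
        simp [h.collapse_tree, rank_tree, rank_extra, Prod.Lex.toLex_lt_toLex] at hab
      · push Not at hq
        rw [← hd] at hab
        simp [collapse_tree_of_notMem q hq, rank_vertex, rank_extra,
          Prod.Lex.toLex_lt_toLex] at hab
    | extra q =>
      rw [← hd] at hab
      simpa [collapse_extra, rank_extra, Prod.Lex.toLex_lt_toLex] using hab

end IsCollapse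

end Rig

/-- The morphism of rigid quivers induced by a contraction of the spanning trees. -/
noncomputable def Rigid.ofIsCollapse {X : FinQuiver.{u} → Prop} {P Q : Rigid X}
    {m : Q.rig.forest.Node → P.rig.forest.Node}
    {ψ : Option P.rig.forest.Node → Option Q.rig.forest.Node} {hk : P.rig.extra = Q.rig.extra}
    (h : P.rig.IsCollapse Q.rig m ψ hk) : P ⟶ Q where
  hom := h.minorHom
  isContraction e := h.collapse_ne_star (c := Cell.edge e) (by simp)
  mono := h.rank_lt

end FinQuiver

/-! ## Well-quasi-ordering of rigid quivers over a fixed quiver -/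

namespace FinQuiver

open Cell PlanarForest

/-- The positions at which the list `f`, of length at most `g`, takes the value `a`. -/
def marks (g : ℕ) {k : ℕ} {α : Type*} (f : Fin k → α) (a : α) : Fin g → Prop :=
  fun i => ∃ h : i < k, f ⟨i, h⟩ = a

namespace Rig

variable {P Q d : FinQuiver.{u}}

/-- The sources of the edges outside of the tree, as nodes of the tree. -/
def srcNode (s : Rig P) (i : Fin s.extra) : Option s.forest.Node :=
  s.vert.symm (P.src (s.edge (Sum.inr i)))

/-- The targets of the edges outside of the tree, as nodes of the tree. -/
def tgtNode (s : Rig P) (i : Fin s.extra) : Option s.forest.Node :=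
  s.vert.symm (P.tgt (s.edge (Sum.inr i)))

/-- What a minor morphism to `d` does at the node `p`, which edges outside of the tree are attached
there, and the direction of the edge between `p` and its parent. -/
def nodeLabel (g : ℕ) (s : Rig P) (φ : MinorHom P d) (p : s.forest.Node) :
    Prop × Cell d × Cell d × (Fin g → Prop) × (Fin g → Prop) :=
  (P.src (s.edge (Sum.inl p)) = s.vert (some p), φ.toFun (Cell.edge (s.edge (Sum.inl p))),
    φ.toFun (vertex (s.vert (some p))), marks g s.srcNode (some p), marks g s.tgtNode (some p))

/-- The nodes whose edge to the parent is not contracted. -/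
abbrev CriticalNode (s : Rig P) (φ : MinorHom P d) : Type :=
  {p : s.forest.Node // ∀ x, φ.toFun (Cell.edge (s.edge (Sum.inl p))) ≠ vertex x}

/-- Combined with the count of uncontracted edges of `P`, the equality of tree edges and non-root
vertices leaves a bound independent of the size of `P`. Hence this number takes finitely many values
in a family of bounded genus. -/
theorem card_criticalNode_le (s : Rig P) (φ : MinorHom P d) :
    Nat.card (s.CriticalNode φ) ≤ P.genus + Nat.card d.V := by
  have h1 := φ.card_not_contracted_add_le
  have h2 : Nat.card (s.CriticalNode φ) ≤
      Nat.card {e : P.E // ∀ x, φ.toFun (Cell.edge e) ≠ vertex x} :=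
    Nat.card_le_card_of_injective (fun p => ⟨s.edge (Sum.inl p.1), p.2⟩) fun p q h =>
      Subtype.ext (by simpa using h)
  have := s.extra_le_genus
  rw [s.card_vertices, s.card_edges] at h1
  omega

/-- Each end of an extra edge is marked at exactly one node or at the virtual root. Since marks
agree along `m` and at the virtual root, the end of the `i`-th extra edge of `P` is the lift of the
corresponding end in `Q`, and `ψ` sends it back. -/
theorem isCollapse_of_labels {g : ℕ} {s : Rig P} {t : Rig Q} {φ : MinorHom P d} {χ : MinorHom Q d}
    {m : t.forest.Node → s.forest.Node} {ψ : Option s.forest.Node → Option t.forest.Node}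
    (hk : s.extra = t.extra) (hg : s.extra ≤ g) (h : IsContraction m ψ)
    (hlabel : ∀ p, s.nodeLabel g φ (m p) = t.nodeLabel g χ p)
    (hsrc : marks g s.srcNode none = marks g t.srcNode none)
    (htgt : marks g s.tgtNode none = marks g t.tgtNode none) : s.IsCollapse t m ψ hk := by
  have key : ∀ (fs : Fin s.extra → Option s.forest.Node) (ft : Fin t.extra → Option t.forest.Node),
      (∀ p, marks g fs (some (m p)) = marks g ft (some p)) → marks g fs none = marks g ft none →
      ∀ i, ψ (fs i) = ft (Fin.cast hk i) := by
    intro fs ft h1 h2 i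
    cases hi : ft (Fin.cast hk i) with
    | none =>
      have : marks g ft none ⟨i, i.2.trans_le hg⟩ := ⟨hk ▸ i.2, hi⟩
      rw [← h2] at this
      obtain ⟨_, h3⟩ := this
      rw [show fs i = none from h3, h.map_root]
    | some p =>
      have : marks g ft (some p) ⟨i, i.2.trans_le hg⟩ := ⟨hk ▸ i.2, hi⟩
      rw [← h1] at this
      obtain ⟨_, h3⟩ := this
      rw [show fs i = some (m p) from h3, h.map_some]
  simp only [nodeLabel, Prod.mk.injEq, eq_iff_iff] at hlabel
  exact ⟨h, fun p => (hlabel p).1, key s.srcNode t.srcNode (fun p => (hlabel p).2.2.2.1) hsrc,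
    key s.tgtNode t.tgtNode (fun p => (hlabel p).2.2.2.2) htgt⟩

/-- Labels settle all cells that come from `Q`. The remaining tree edges must be contracted by `φ`,
and this is where equality of the numbers of critical nodes enters. -/
theorem IsCollapse.comp_eq {g : ℕ} {s : Rig P} {t : Rig Q} {φ : MinorHom P d} {χ : MinorHom Q d}
    {m : t.forest.Node → s.forest.Node} {ψ : Option s.forest.Node → Option t.forest.Node}
    {hk : s.extra = t.extra} (h : s.IsCollapse t m ψ hk)
    (hlabel : ∀ p, s.nodeLabel g φ (m p) = t.nodeLabel g χ p)
    (hroot : φ.toFun (vertex (s.vert none)) = χ.toFun (vertex (t.vert none)))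
    (hextra : ∀ i, φ.toFun (Cell.edge (s.edge (Sum.inr i))) =
      χ.toFun (Cell.edge (t.edge (Sum.inr (Fin.cast hk i)))))
    (hcard : Nat.card (s.CriticalNode φ) = Nat.card (t.CriticalNode χ)) (c : Cell P) :
    χ.toFun (collapse s t m ψ hk c) = φ.toFun c := by
  simp only [nodeLabel, Prod.mk.injEq, eq_iff_iff] at hlabel
  -- The map `m` injects critical nodes into critical nodes; having equal finite cardinality, it is
  -- onto, so a node outside its image is not critical.
  have hcrit : ∀ p, (∀ q, m q ≠ p) → ∃ x, φ.toFun (Cell.edge (s.edge (Sum.inl p))) = vertex x := by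
    intro p hp
    by_contra hne
    push Not at hne
    let f : t.CriticalNode χ → s.CriticalNode φ := fun q => ⟨m q.1, fun x => by
      rw [(hlabel q.1).2.1]
      exact q.2 x⟩
    have hf : Function.Injective f := fun q q' hq =>
      Subtype.ext (h.isContraction.injective (congrArg Subtype.val hq))
    obtain ⟨q, hq⟩ := ((Nat.bijective_iff_injective_and_card f).2 ⟨hf, hcard.symm⟩).2 ⟨p, hne⟩
    exact hp q.1 (congrArg Subtype.val hq)
  -- Induction from the root: at a node outside the image of `m`, both `ψ` and `φ` take the same
  -- value as at the parent.
  have hvert : ∀ a, χ.toFun (vertex (t.vert (ψ a))) = φ.toFun (vertex (s.vert a)) := by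
    intro a
    induction hn : idxRoot a using Nat.strong_induction_on generalizing a with
    | _ n ih =>
      subst hn
      rcases a with _ | p
      · rw [h.isContraction.map_root, hroot]
      · by_cases hp : ∃ q, m q = p
        · obtain ⟨q, rfl⟩ := hp
          rw [h.isContraction.map_some, (hlabel q).2.2.1]
        · push Not at hp
          obtain ⟨x, hx⟩ := hcrit p hp
          obtain ⟨h1, h2⟩ := φ.compat.ends hx
          rw [h.isContraction.map_of_notMem p hp, ih _ (idxRoot_parent_lt p) _ rfl]
          rcases s.ends p with ⟨h3, h4⟩ | ⟨h3, h4⟩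
          · rw [← h3, ← h4, h1, h2]
          · rw [← h3, ← h4, h1, h2]
  induction c using s.cell_cases with
  | star => rw [collapse_star, χ.map_star, φ.map_star]
  | vertex a => rw [collapse_vertex, hvert]
  | tree p =>
    by_cases hp : ∃ q, m q = p
    · obtain ⟨q, rfl⟩ := hp
      rw [h.collapse_tree, (hlabel q).2.1]
    · push Not at hp
      obtain ⟨x, hx⟩ := hcrit p hp
      obtain ⟨h1, h2⟩ := φ.compat.ends hx
      rw [collapse_tree_of_notMem p hp, hvert, hx]
      rcases s.ends p with ⟨h3, h4⟩ | ⟨h3, h4⟩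
      · rw [← h3, h1]
      · rw [← h4, h2]
  | extra i => rw [collapse_extra, hextra]

end Rig

namespace Rigid

variable {X : FinQuiver.{u} → Prop}

/-- Among infinitely many rigid quivers of bounded genus with minor morphisms to a fixed quiver, one
is a contraction of a later one, compatibly with the minor morphisms. -/
theorem exists_factorization (g : ℕ) (hX : ∀ Q, X Q → Q.genus ≤ g) (d : FinQuiver.{u})
    (P : ℕ → Rigid X) (φ : ∀ n, (P n).quiver ⟶ d) :
    ∃ i j, i < j ∧ ∃ ψ : P j ⟶ P i, ψ.hom ≫ φ i = φ j := by
  have hk : ∀ n, (P n).rig.extra < g + 1 := fun n =>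
    Nat.lt_succ_of_le ((P n).rig.extra_le_genus.trans (hX _ (P n).prop))
  have hc : ∀ n, Nat.card ((P n).rig.CriticalNode (φ n)) < g + Nat.card d.V + 1 := fun n =>
    Nat.lt_succ_of_le (((P n).rig.card_criticalNode_le (φ n)).trans
      (Nat.add_le_add_right (hX _ (P n).prop) _))
  let A := Fin (g + 1) × Fin (g + Nat.card d.V + 1) × Cell d × (Fin g → Prop) × (Fin g → Prop) ×
    (Cell d → Fin g → Prop)
  let Λ := Prop × Cell d × Cell d × (Fin g → Prop) × (Fin g → Prop)
  -- The data not carried by the nodes. `marks` stores the images of the extra edges, a list whose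
  -- length varies with `n`, in one fixed finite type.
  let a : ℕ → A := fun n => (⟨_, hk n⟩, ⟨_, hc n⟩, (φ n).toFun (vertex ((P n).rig.vert none)),
    marks g (P n).rig.srcNode none, marks g (P n).rig.tgtNode none,
    marks g (fun i => (φ n).toFun (Cell.edge ((P n).rig.edge (Sum.inr i)))))
  let F : ℕ → Labelled Λ := fun n => ⟨(P n).rig.forest, (P n).rig.nodeLabel g (φ n)⟩
  obtain ⟨i, j, hij, he, hF⟩ := (Finite.wellQuasiOrdered (Eq : A → A → Prop)).prod
    (wellQuasiOrdered_isContractionOf Λ) (fun n => (a n, F n))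
  refine ⟨i, j, hij, ?_⟩
  obtain ⟨m, ψ, h, hlabel⟩ := hF
  simp only [a, A, Prod.mk.injEq, Fin.mk.injEq] at he
  obtain ⟨h1, h2, h3, h4, h5, h6⟩ := he
  have hcol := Rig.isCollapse_of_labels h1.symm (Nat.le_of_lt_succ (hk j)) h hlabel h4.symm h5.symm
  refine ⟨ofIsCollapse hcol, MinorHom.ext (funext fun c => ?_)⟩
  refine hcol.comp_eq hlabel h3.symm (fun e => ?_) h2.symm c
  have hm : marks g (fun e => (φ j).toFun (Cell.edge ((P j).rig.edge (Sum.inr e))))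
      ((φ j).toFun (Cell.edge ((P j).rig.edge (Sum.inr e))))
      ⟨e, e.2.trans_le (Nat.le_of_lt_succ (hk j))⟩ := ⟨e.2, rfl⟩
  rw [← h6] at hm
  obtain ⟨_, h7⟩ := hm
  exact h7.symm

/-! ### Essential smallness and the Gröbner property -/

/-- A complete invariant of rigid quivers. -/
def code (P : Rigid X) : Σ (S : PlanarForest) (k : ℕ),
    (S.Node → Prop) × (Fin k → Option S.Node) × (Fin k → Option S.Node) :=
  ⟨P.rig.forest, P.rig.extra,
    fun p => P.quiver.src (P.rig.edge (Sum.inl p)) = P.rig.vert (some p),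
    P.rig.srcNode, P.rig.tgtNode⟩

theorem nonempty_hom_of_code_eq {P Q : Rigid X} (h : P.code = Q.code) : Nonempty (P ⟶ Q) := by
  suffices H : ∃ (m : Q.rig.forest.Node → P.rig.forest.Node)
      (ψ : Option P.rig.forest.Node → Option Q.rig.forest.Node) (hk : P.rig.extra = Q.rig.extra),
      P.rig.IsCollapse Q.rig m ψ hk by
    obtain ⟨m, ψ, hk, H⟩ := H
    exact ⟨ofIsCollapse H⟩
  obtain ⟨P, _, S, k, v, e, hs⟩ := P
  obtain ⟨Q, _, S', k', v', e', hs'⟩ := Q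
  simp only [code] at h
  obtain ⟨rfl, h⟩ := Sigma.mk.inj_iff.1 h
  obtain ⟨rfl, h⟩ := Sigma.mk.inj_iff.1 (eq_of_heq h)
  simp only [heq_eq_eq, Prod.mk.injEq] at h
  obtain ⟨h1, h2, h3⟩ := h
  exact ⟨fun x => x, fun x => x, rfl, IsContraction.refl _, fun p => (congrFun h1 p).to_iff,
    fun i => congrFun h2 i, fun i => congrFun h3 i⟩

/-- Morphisms in both directions are mutually inverse because every endomorphism is the identity
(`eq_id`). -/
theorem nonempty_iso_of_code_eq {P Q : Rigid X} (h : P.code = Q.code) : Nonempty (P ≅ Q) := by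
  obtain ⟨φ⟩ := nonempty_hom_of_code_eq h
  obtain ⟨ψ⟩ := nonempty_hom_of_code_eq h.symm
  exact ⟨⟨φ, ψ, eq_id _, eq_id _⟩⟩

/-- A code determines the isomorphism class, and codes form a type in the lowest universe. -/
instance : EssentiallySmall.{u} (Rigid X) := by
  rw [essentiallySmall_iff]
  refine ⟨?_, inferInstance⟩
  have hinj : Function.Injective (fun P : Skeleton (Rigid X) => ((fromSkeleton _).obj P).code) := by
    intro P Q h
    obtain ⟨e⟩ := nonempty_iso_of_code_eq h
    exact skeleton_skeletal _ ⟨(fromSkeleton _).preimageIso e⟩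
  have : Small.{u} (Σ (S : PlanarForest) (k : ℕ),
      (S.Node → Prop) × (Fin k → Option S.Node) × (Fin k → Option S.Node)) :=
    small_lift.{0, u, 0} _
  exact small_of_injective hinj

/-- Rigid quivers of bounded genus form a Gröbner category. -/
theorem isGrobner_op (g : ℕ) (hX : ∀ Q, X Q → Q.genus ≤ g) :
    GrobnerCat.IsGrobner.{u + 1, u} (Rigid X)ᵒᵖ := by
  refine ⟨inferInstance, fun c => ⟨orderable c, ⟨fun f => ?_⟩⟩⟩
  let r : ℕ → GrobnerCat.Total (coyoneda.obj (Opposite.op c)) := fun n =>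
    ofAntisymmetrization (· ≤ ·) (f n)
  obtain ⟨i, j, hij, ψ, hψ⟩ := exists_factorization g hX c.unop.quiver
    (fun n => (r n).1.unop) (fun n => ((r n).2 : c ⟶ (r n).1).unop.hom)
  refine ⟨i, j, hij, ?_⟩
  rw [← toAntisymmetrization_ofAntisymmetrization (· ≤ ·) (f i),
    ← toAntisymmetrization_ofAntisymmetrization (· ≤ ·) (f j)]
  refine toAntisymmetrization_le_toAntisymmetrization_iff.2 ⟨ψ.op, ?_⟩
  change ((r i).2 : c ⟶ (r i).1) ≫ ψ.op = (r j).2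
  -- A rigid morphism is determined by its minor morphism, so a factorization over the bare quiver
  -- of `c` is one in the rigid category.
  exact Quiver.Hom.unop_inj (Hom.ext hψ)

end Rigid

end FinQuiver

/-! ## Quasi-Gröbner categories -/

namespace GrobnerCat

/-- Property (F) holds if the morphisms to the images of objects are well-quasi-ordered. -/
theorem PropertyF.of_wellQuasiOrdered {C D : Type*} [Category* C] [Category* D] (F : C ⥤ D)
    (h : ∀ (d : D) (x : ℕ → C) (f : ∀ n, d ⟶ F.obj (x n)),
      ∃ i j, i < j ∧ ∃ γ : x i ⟶ x j, f j = f i ≫ F.map γ) : PropertyF F := by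
  intro d
  by_contra hne
  -- If no finite family suffices, every finite set of morphisms misses one; iterating gives a
  -- sequence in which no term factors through an earlier one.
  obtain ⟨f, -, hf⟩ := exists_seq_of_forall_finset_exists (α := Σ x : C, d ⟶ F.obj x)
    (fun _ => True) (fun a b => ¬ ∃ γ : a.1 ⟶ b.1, b.2 = a.2 ≫ F.map γ) (by
      intro s _
      by_contra hs
      push Not at hs
      refine hne ⟨s.card, fun i => (s.equivFin.symm i).1.1, fun i => (s.equivFin.symm i).1.2, ?_⟩
      intro x f
      obtain ⟨a, ha, γ, hγ⟩ := hs ⟨x, f⟩ trivial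
      obtain ⟨i, hi⟩ := s.equivFin.symm.surjective ⟨a, ha⟩
      refine ⟨i, ?_⟩
      change ∃ γ : (s.equivFin.symm i).1.1 ⟶ x, f = (s.equivFin.symm i).1.2 ≫ F.map γ
      rw [hi]
      exact ⟨γ, hγ⟩)
  obtain ⟨i, j, hij, γ, hγ⟩ := h d (fun n => (f n).1) (fun n => (f n).2)
  exact hf i j hij ⟨γ, hγ⟩

theorem essentiallySmall_of_essSurj {C : Type*} [Category* C] {D : Type*} [Category.{u} D]
    [EssentiallySmall.{u} C] (F : C ⥤ D) [F.EssSurj] : EssentiallySmall.{u} D := by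
  rw [essentiallySmall_iff]
  refine ⟨?_, inferInstance⟩
  exact small_of_surjective F.mapSkeleton_surjective

end GrobnerCat

namespace FinQuiver

variable {X : FinQuiver.{u} → Prop}

/-- A criterion for categories of quivers of bounded genus: it suffices to lift every quiver to a
rigid quiver, and to factor morphisms along morphisms of rigid quivers. -/
theorem isQuasiGrobner_op {C : Type (u + 1)} [Category.{u} C] (g : ℕ)
    (hX : ∀ Q, X Q → Q.genus ≤ g) (F : Rigid X ⥤ C) (hF : Function.Surjective F.obj)
    (h : ∀ (d : C) (P : ℕ → Rigid X) (f : ∀ n, F.obj (P n) ⟶ d),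
      ∃ i j, i < j ∧ ∃ ψ : P j ⟶ P i, F.map ψ ≫ f i = f j) :
    GrobnerCat.IsQuasiGrobner Cᵒᵖ := by
  have hF' : F.EssSurj := ⟨fun d => by
    obtain ⟨P, rfl⟩ := hF d
    exact ⟨P, ⟨Iso.refl _⟩⟩⟩
  have := GrobnerCat.essentiallySmall_of_essSurj F
  refine ⟨inferInstance, (Rigid X)ᵒᵖ, inferInstance, F.op, Rigid.isGrobner_op g hX,
    inferInstance, GrobnerCat.PropertyF.of_wellQuasiOrdered _ fun d P f => ?_⟩
  obtain ⟨i, j, hij, ψ, hψ⟩ := h d.unop (fun n => (P n).unop) (fun n => (f n).unop)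
  exact ⟨i, j, hij, ψ.op, Quiver.Hom.unop_inj hψ.symm⟩

/-! ### The forgetful functors to the three categories -/

namespace Rigid

/-- Forgetting the spanning trees. -/
def toFullSubcategory (X : ObjectProperty FinQuiver.{u}) : Rigid X ⥤ X.FullSubcategory where
  obj P := ⟨P.quiver, P.prop⟩
  map φ := ObjectProperty.homMk φ.hom

/-- Forgetting the spanning trees, but not that the morphisms are contractions. -/
def toContractions (X : ObjectProperty FinQuiver.{u}) : Rigid X ⥤
    ObjectProperty.FullSubcategory (fun Q : WideSubcategory contractions.{u} => X Q.obj) where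
  obj P := ⟨⟨P.quiver⟩, P.prop⟩
  map φ := ObjectProperty.homMk ⟨φ.hom, φ.isContraction⟩

variable {X : ObjectProperty FinQuiver.{u}} (hconn : ∀ Q, X Q → Q.Connected) (g : ℕ)
  (hX : ∀ Q, X Q → Q.genus ≤ g)

include hconn hX

/-- The factorization only relates two members of the given sequence, so `X` need not be closed
under minors; this lets digraphs be treated like all quivers. -/
theorem isQuasiGrobner_fullSubcategory : GrobnerCat.IsQuasiGrobner X.FullSubcategoryᵒᵖ := by
  refine isQuasiGrobner_op g hX (toFullSubcategory X) ?_ ?_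
  · rintro ⟨Q, hQ⟩
    obtain ⟨t⟩ := (hconn Q hQ).nonempty_rig
    exact ⟨⟨Q, hQ, t⟩, rfl⟩
  · intro d P f
    obtain ⟨i, j, hij, ψ, hψ⟩ := exists_factorization g hX d.obj P (fun n => (f n).hom)
    exact ⟨i, j, hij, ψ, ObjectProperty.hom_ext _ hψ⟩

/-- Rigid morphisms are contractions, so the factorization found among minor morphisms already lies
in the wide subcategory. -/
theorem isQuasiGrobner_contractions : GrobnerCat.IsQuasiGrobner
    (ObjectProperty.FullSubcategory
      (fun Q : WideSubcategory contractions.{u} => X Q.obj))ᵒᵖ := by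
  refine isQuasiGrobner_op g hX (toContractions X) ?_ ?_
  · rintro ⟨⟨Q⟩, hQ⟩
    obtain ⟨t⟩ := (hconn Q hQ).nonempty_rig
    exact ⟨⟨Q, hQ, t⟩, rfl⟩
  · intro d P f
    obtain ⟨i, j, hij, ψ, hψ⟩ := exists_factorization g hX d.obj.obj P (fun n => (f n).hom.hom)
    exact ⟨i, j, hij, ψ, ObjectProperty.hom_ext _ (WideSubcategory.hom_ext _ hψ)⟩

end Rigid

end FinQuiver

theorem theorem3 (g : ℕ) :
    GrobnerCat.IsQuasiGrobner (FinQuiver.QuiverLE.{u} g)ᵒᵖ ∧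
    GrobnerCat.IsQuasiGrobner (FinQuiver.CQuiverLE.{u} g)ᵒᵖ ∧
    GrobnerCat.IsQuasiGrobner (FinQuiver.DigraphLE.{u} g)ᵒᵖ :=
  ⟨FinQuiver.Rigid.isQuasiGrobner_fullSubcategory (fun _ h => h.1) g (fun _ h => h.2),
    FinQuiver.Rigid.isQuasiGrobner_contractions (X := FinQuiver.genusLE g) (fun _ h => h.1) g
      (fun _ h => h.2),
    FinQuiver.Rigid.isQuasiGrobner_fullSubcategory (fun _ h => h.1.1) g (fun _ h => h.1.2)⟩
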